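/- **Setting.** Let $\mathfrak n=\mathfrak h_3\oplus\mathbb R$ have the orthonormal basis $e_1,e_2,e_3,e_4$, whose only non-trivial bracket is $[e_1,e_2]=e_3$, and dual basis $e^1,\dots,e^4$. Let $N=H_3\times\mathbb R$ be the simply connected Lie group of $\mathfrak n$ with the corresponding left-invariant metric, and write tangent vectors of $N$ as $pV$ with $p\in N$, $V\in\mathfrak n$ (left translation of $V$). For an invariant $2$-form $\omega$ on $N$ let $F$ be the skew-symmetric endomorphism with $\langle FX,Y\rangle=\omega(X,Y)$. For a discrete cocompact subgroup $\Gamma\subset N$ the metric and $\omega$ descend to $M=\Gamma\backslash N$. Magnetic trajectories are the curves with $\nabla_{\gamma'}\gamma'=F\gamma'$, the energy is $\mathrm E(pV)=\frac12\|V\|^2$, and $TM$ carries the Poisson bracket of the symplectic form $-d\eta+\pi^*\omega$, where $\eta$ is the tautological $1$-form $\eta_{pV}(A)=\langle\pi_*A,pV\rangle$. A first integral is a smooth function on $TM$ that is constant along the velocity $\gamma'$ of each magnetic trajectory. The flow is completely integrable by $\Psi_1,\Psi_2,\Psi_3$ if these are Poisson commuting first integrals and the differentials of $\mathrm E,\Psi_1,\Psi_2,\Psi_3$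 are linearly independent on a dense subset of $TM$; it is so at the energy level $E$ if they are Poisson commuting first integrals and these differentials are linearly independent on a dense subset of $\{\mathrm E=E\}$. For $\xi\in\mathfrak n$ and $p=\exp W$ put $$\phi_\xi(pV)=\langle pV,\xi p\rangle+\langle F\xi,W\rangle-\tfrac12\sum_{i,j\in\{1,2\}}\langle e_i,W\rangle\langle e_j,W\rangle\langle F[e_i,\xi],e_j\rangle ,$$ where $\xi p$ is the right translation of $\xi$ by $p$, and $I_j=\phi_{e_j}$. **Theorem.** Let $\omega=a\,e^{13}+b\,e^{23}+c\,e^{14}+\rho\,e^{12}$ with $a,b,c,\rho\in\mathbb R$, and assume that $F$ has rank $2$. Then $bc=0$, and the following hold. 1. Let $b=0$ and $\Lambda=\mathrm{Span}_{\mathbb Z}(2e_1,e_2,e_3,e_4)$. Then $\Gamma=\exp(\Lambda)$ is a discrete cocompact subgroup of $N$, and the functions $$f_2=\begin{cases}I_2-\frac1{2a}(I_3+\rho)^2& a\ne0\\ e^{-1/(I_3+\rho)^2}\sin\!\big(\frac{\pi I_2}{I_3+\rho}\big)& a=0\end{cases},\quad f_3=\begin{cases}\sin(\frac\pi aI_3)&a\neq0\\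 I_3&a=0\end{cases},\quad f_4=\begin{cases}\sin(\frac\pi cI_4)&c\neq0\\ I_4&c=0\end{cases}$$ (with $f_2=0$ where $a=0$ and $I_3+\rho=0$) descend to $T(\Gamma\backslash N)$. The magnetic flow on $\Gamma\backslash N$ is completely integrable by $f_2,f_3,f_4$, also at every energy level $E>0$. If $a\ne0$, then $f_2,f_3,f_4$ are real analytic. If $a=0$, they are real analytic at all points of every energy level $E<\rho^2/2$, whereas for $E\ge\rho^2/2$ the (smooth) functions $f_2,f_3,f_4$ are not all real analytic at all points of the level $E$; if moreover $E>0$, then not even their restrictions to the level $E$ are all real analytic. 2. Let $c=0$, $b\ne0$, and let $\Lambda=\mathrm{Span}_{\mathbb Z}(2e_1,\frac1be_2,\frac1be_3,e_4)$ if $a=0$ and $\Lambda=\mathrm{Span}_{\mathbb Z}(\frac2ae_1,\frac1be_2,\frac1{ab}e_3,e_4)$ if $a\ne0$. Then $\Gamma=\exp(\Lambda)$ is a discrete cocompact subgroup of $N$, and the functions $$g_2=bI_1-aI_2+\tfrac12(I_3+\rho)^2,\qquad g_3=\sin(2\pi I_3),\qquad g_4=I_4$$ descend to real analytic functions on $T(\Gamma\backslash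 N)$. The magnetic flow on $\Gamma\backslash N$ is completely integrable by $g_2,g_3,g_4$, also at every energy level $E>0$. In particular, for $\rho\neq0$, the conclusions of 1 (case $a=c=0$, with $\rho$ replaced by $-\rho$ in the formulas for $f_2,f_3,f_4$) hold for the exact form $\rho\,de^3=-\rho\,e^{12}$. -/

import Mathlib

open scoped InnerProductSpace Topology

noncomputable section

namespace KodairaThurston

/-! ### The Lie algebra `𝔥₃ ⊕ ℝ` with its scalar product -/

/-- The Lie algebra `𝔥₃ ⊕ ℝ` with the scalar product for which the basis `e₁, e₂, e₃, e₄` is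
orthonormal.  The vector written `eᵢ` on paper has index `i - 1` in `Fin 4`. -/
abbrev Alg : Type := EuclideanSpace ℝ (Fin 4)

/-- The orthonormal basis; `e 0, e 1, e 2, e 3` are `e₁, e₂, e₃, e₄`. -/
def e (i : Fin 4) : Alg := EuclideanSpace.single i 1

/-- The dual basis; `dual 0, …, dual 3` are `e¹, …, e⁴`. -/
def dual (i : Fin 4) : Alg →ₗ[ℝ] ℝ := (EuclideanSpace.proj i : Alg →L[ℝ] ℝ).toLinearMap

lemma dual_apply (i : Fin 4) (X : Alg) : dual i X = X i := rfl

/-- Bilinear forms on the Lie algebra (left-invariant 2-forms, when alternating). -/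
abbrev Form : Type := Alg →ₗ[ℝ] Alg →ₗ[ℝ] ℝ

/-- The wedge product `α ∧ β` of two 1-forms: `(X, Y) ↦ α X * β Y - β X * α Y`. -/
def wedge (α β : Alg →ₗ[ℝ] ℝ) : Form := α.smulRight β - β.smulRight α

/-- The Lie bracket, whose only non-trivial relation on the basis is `[e₁, e₂] = e₃`. -/
def bracket : Alg →ₗ[ℝ] Alg →ₗ[ℝ] Alg :=
  (wedge (dual 0) (dual 1)).compr₂ (LinearMap.toSpanSingleton ℝ Alg (e 2))

/-- The exterior differential of a left-invariant 1-form: `dα (X, Y) = - α [X, Y]`. -/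
def extDiff (α : Alg →ₗ[ℝ] ℝ) : Form := -(bracket.compr₂ α)

/-- The 2-form `a e¹³ + b e²³ + c e¹⁴ + ρ e¹²`. -/
def magneticForm (a b c ρ : ℝ) : Form :=
  a • wedge (dual 0) (dual 2) + b • wedge (dual 1) (dual 2) + c • wedge (dual 0) (dual 3)
    + ρ • wedge (dual 0) (dual 1)

/-- The Lorentz force `F` of the magnetic field `ω`, characterised by `⟨F X, Y⟩ = ω (X, Y)`. -/
def lorentz (ω : Form) : Alg →ₗ[ℝ] Alg :=
  ∑ j, (ω.flip (e j)).smulRight (e j)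

/-- The Levi-Civita connection of the left-invariant metric on left-invariant vector fields,
by Koszul's formula
`2 ⟨∇_X Y, Z⟩ = ⟨[X, Y], Z⟩ - ⟨[Y, Z], X⟩ + ⟨[Z, X], Y⟩`. -/
def leviCivita (X Y : Alg) : Alg :=
  ∑ k, ((1 / 2 : ℝ) * (⟪bracket X Y, e k⟫_ℝ - ⟪bracket Y (e k), X⟫_ℝ
    + ⟪bracket (e k) X, Y⟫_ℝ)) • e k

/-! ### The simply connected Lie group `H₃ × ℝ` in exponential coordinates -/

/-- The simply connected Lie group `N = H₃ × ℝ` with Lie algebra `𝔥₃ ⊕ ℝ`: the space `ℝ⁴` with the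
product `(p, q) ↦ p + q + (1/2) [p, q]`. -/
def Nil : Type := EuclideanSpace ℝ (Fin 4)

instance : NormedAddCommGroup Nil := inferInstanceAs (NormedAddCommGroup (EuclideanSpace ℝ (Fin 4)))
instance : NormedSpace ℝ Nil := inferInstanceAs (NormedSpace ℝ (EuclideanSpace ℝ (Fin 4)))

/-- The exponential map of `N`; in these coordinates the one-parameter subgroups are the lines
`t ↦ t X`, so that the exponential map is the identity of `ℝ⁴`. -/
def expN : Alg ≃L[ℝ] Nil := ContinuousLinearEquiv.refl ℝ (EuclideanSpace ℝ (Fin 4))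

/-- The inverse of the exponential map. -/
def logN : Nil ≃L[ℝ] Alg := expN.symm

lemma bracket_apply (X Y : Alg) : bracket X Y = (X 0 * Y 1 - X 1 * Y 0) • e 2 := by
  simp [bracket, wedge, dual_apply]

instance : Mul Nil := ⟨fun p q =>
  expN (logN p + logN q + (1 / 2 : ℝ) • bracket (logN p) (logN q))⟩
instance : One Nil := ⟨expN 0⟩
instance : Inv Nil := ⟨fun p => expN (-logN p)⟩

/-- The Baker–Campbell–Hausdorff formula. -/
lemma expN_mul_expN (X Y : Alg) :
    expN X * expN Y = expN (X + Y + (1 / 2 : ℝ) • bracket X Y) := rfl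

lemma bch_assoc (X Y Z : Alg) :
    X + Y + (1 / 2 : ℝ) • bracket X Y + Z
        + (1 / 2 : ℝ) • bracket (X + Y + (1 / 2 : ℝ) • bracket X Y) Z
      = X + (Y + Z + (1 / 2 : ℝ) • bracket Y Z)
        + (1 / 2 : ℝ) • bracket X (Y + Z + (1 / 2 : ℝ) • bracket Y Z) := by
  simp only [bracket_apply]
  ext i
  fin_cases i <;> simp [e] <;> ring

lemma bch_neg (X : Alg) : -X + X + (1 / 2 : ℝ) • bracket (-X) X = 0 := by
  simp only [bracket_apply]
  ext i
  fin_cases i <;> simp [e] <;> ring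

lemma bch_zero (X : Alg) : 0 + X + (1 / 2 : ℝ) • bracket 0 X = X := by simp

instance : Group Nil :=
  Group.ofLeftAxioms (fun p q r => bch_assoc p q r) (fun p => bch_zero p) (fun p => bch_neg p)

/-- The tangent vector `p V ∈ T_p N`, image of `V` under the differential of the left translation
by `p` (tangent spaces of `N` are written in the coordinates of `ℝ⁴`). -/
def leftVec (p : Nil) (V : Alg) : Nil := fderiv ℝ (fun X : Alg => p * expN X) 0 V

/-- The tangent vector `V p ∈ T_p N`, image of `V` under the differential of the right translation
by `p`; this is the value at `p` of the right-invariant vector field determined by `V`. -/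
def rightVec (p : Nil) (V : Alg) : Nil := fderiv ℝ (fun X : Alg => expN X * p) 0 V

/-- The left Maurer–Cartan form: `ξ ∈ T_p N` is sent to the `X` in the Lie algebra with
`ξ = p X`. -/
def maurerCartan (p ξ : Nil) : Alg := fderiv ℝ (fun q : Nil => logN (p⁻¹ * q)) p ξ

/-! ### The tangent bundle of `N` and its twisted symplectic form -/

/-- The tangent bundle of `N`, trivialised by left translations: the pair `(p, V)` stands for the
tangent vector `p V`. -/
abbrev TN : Type := Nil × Alg

/-- The kinetic energy `⟨V, V⟩ / 2` of the tangent vector `p V`. -/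
def energy (u : TN) : ℝ := (1 / 2 : ℝ) * ⟪u.2, u.2⟫_ℝ

/-- The tautological 1-form `η` of `TN`: `η_{pV} (A) = g (π_* A, p V)`. -/
def taut (u A : TN) : ℝ := ⟪maurerCartan u.1 A.1, u.2⟫_ℝ

/-- The exterior differential `dη` of the tautological 1-form, in the coordinates of `ℝ⁴ × ℝ⁴`. -/
def dTaut (u A B : TN) : ℝ :=
  fderiv ℝ (fun v => taut v B) u A - fderiv ℝ (fun v => taut v A) u B

/-- The twisted symplectic form `Ω^F = -dη + π^* ω^F`. -/
def twistedForm (ω : Form) (u A B : TN) : ℝ :=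
  -dTaut u A B + ω (maurerCartan u.1 A.1) (maurerCartan u.1 B.1)

/-- `X` is the value at `u` of the Hamiltonian vector field of `φ`: `Ω^F (X, U) = dφ (U)` for
all `U`. -/
def IsHamiltonianVector (ω : Form) (φ : TN → ℝ) (u X : TN) : Prop :=
  ∀ U : TN, twistedForm ω u X U = fderiv ℝ φ u U

/-- The Hamiltonian vector field of `φ`. -/
def hamiltonianField (ω : Form) (φ : TN → ℝ) (u : TN) : TN :=
  Classical.epsilon (IsHamiltonianVector ω φ u)

/-- The Poisson bracket `{φ, ψ}^F = Ω^F (X_φ, X_ψ)`. -/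
def poisson (ω : Form) (φ ψ : TN → ℝ) (u : TN) : ℝ :=
  twistedForm ω u (hamiltonianField ω φ u) (hamiltonianField ω ψ u)

/-- `t ↦ p t V t` is, for `|t| < ε`, the velocity of a magnetic trajectory of `N`: the base curve
satisfies `p' = p V`, and `∇_{p'} p' = F p'`, which in the left trivialisation reads
`V' + ∇_V V = F V`. -/
def IsMagneticTrajectory (ω : Form) (ε : ℝ) (c : ℝ → TN) : Prop :=
  ∀ t ∈ Set.Ioo (-ε) ε,
    HasDerivAt (fun s => (c s).1) (leftVec (c t).1 (c t).2) t ∧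
    HasDerivAt (fun s => (c s).2) (lorentz ω (c t).2 - leviCivita (c t).2 (c t).2) t

/-- The function on `TN` attached to the magnetic Killing vector field of `ξ`:
`p V ↦ ⟨p V, ξ p⟩ + f_{F ξ} (p) - (1/2) ∑_{i,j ≤ 2} f_{eᵢ} (p) f_{eⱼ} (p) ⟨F [eᵢ, ξ], eⱼ⟩`, where
`f_X (exp W) = ⟨X, W⟩`. -/
def momentum (ω : Form) (ξ : Alg) (u : TN) : ℝ :=
  ⟪u.2, maurerCartan u.1 (rightVec u.1 ξ)⟫_ℝ + ⟪lorentz ω ξ, logN u.1⟫_ℝ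
    - (1 / 2 : ℝ) * ∑ i ∈ ({0, 1} : Finset (Fin 4)), ∑ j ∈ ({0, 1} : Finset (Fin 4)),
      ⟪e i, logN u.1⟫_ℝ * ⟪e j, logN u.1⟫_ℝ * ⟪lorentz ω (bracket (e i) ξ), e j⟫_ℝ

/-! ### Quotients by lattices -/

/-- The quotient `Γ \ N`, the set of classes `Γ p` with the quotient topology. -/
abbrev Quo (Γ : Subgroup Nil) : Type := Quotient (QuotientGroup.rightRel Γ)

/-- The subgroup `Γ` is a cocompact lattice: discrete, with compact quotient `Γ \ N`. -/
def IsCocompactLattice (Γ : Subgroup Nil) : Prop :=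
  DiscreteTopology Γ ∧ CompactSpace (Quo Γ)

/-- The tangent bundle of `M = Γ \ N`.  Left translations by `Γ` send `p V` to `(γ p) V`, so the
left trivialisation of `TN` descends to `TM`. -/
abbrev TM (Γ : Subgroup Nil) : Type := Quo Γ × Alg

/-- The covering map `TN → TM`, the differential of `N → Γ \ N`; it is a local isomorphism for
all the structures considered (metric, magnetic field, smooth and analytic structure). -/
def proj (Γ : Subgroup Nil) (u : TN) : TM Γ := (Quotient.mk _ u.1, u.2)

/-- The function on `TN` induced by a function on `TM`. -/
def pull {Γ : Subgroup Nil} (Ψ : TM Γ → ℝ) : TN → ℝ := fun u => Ψ (proj Γ u)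

/-- First integrals of the magnetic flow on `Γ \ N`: smooth functions on `TM` that are constant
along the velocities of magnetic trajectories.  The magnetic trajectories of `Γ \ N` are the
projections of those of `N`. -/
def IsFirstIntegral (ω : Form) {Γ : Subgroup Nil} (Ψ : TM Γ → ℝ) : Prop :=
  ContDiff ℝ (⊤ : ℕ∞) (pull Ψ) ∧
  ∀ (ε : ℝ) (c : ℝ → TN), 0 < ε → IsMagneticTrajectory ω ε c →
    ∀ s ∈ Set.Ioo (-ε) ε, ∀ t ∈ Set.Ioo (-ε) ε, Ψ (proj Γ (c s)) = Ψ (proj Γ (c t))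

/-- The functions `Ψ₁, Ψ₂, Ψ₃` Poisson commute for the twisted symplectic form of `TM`. -/
def InInvolution (ω : Form) {Γ : Subgroup Nil} (Ψ : Fin 3 → TM Γ → ℝ) : Prop :=
  ∀ i j u, poisson ω (pull (Ψ i)) (pull (Ψ j)) u = 0

/-- The points of `TM` where the differentials of the energy and of `Ψ₁, Ψ₂, Ψ₃` are linearly
independent. -/
def regularSet {Γ : Subgroup Nil} (Ψ : Fin 3 → TM Γ → ℝ) : Set (TM Γ) :=
  proj Γ '' {u | LinearIndependent ℝ
    ![fderiv ℝ energy u, fderiv ℝ (pull (Ψ 0)) u, fderiv ℝ (pull (Ψ 1)) u,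
      fderiv ℝ (pull (Ψ 2)) u]}

/-- The energy level `E` in `TM`. -/
def level (Γ : Subgroup Nil) (E : ℝ) : Set (TM Γ) := proj Γ '' {u | energy u = E}

/-- The magnetic flow of `Γ \ N` is completely integrable by `Ψ₁, Ψ₂, Ψ₃`. -/
def CompletelyIntegrableBy (ω : Form) {Γ : Subgroup Nil} (Ψ : Fin 3 → TM Γ → ℝ) : Prop :=
  (∀ j, IsFirstIntegral ω (Ψ j)) ∧ InInvolution ω Ψ ∧ Dense (regularSet Ψ)

/-- The magnetic flow of `Γ \ N` is completely integrable by `Ψ₁, Ψ₂, Ψ₃` at the energy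
level `E`: the differentials of the energy and of the `Ψⱼ` are independent on a dense subset of
that level. -/
def CompletelyIntegrableAtLevelBy (ω : Form) {Γ : Subgroup Nil} (E : ℝ)
    (Ψ : Fin 3 → TM Γ → ℝ) : Prop :=
  (∀ j, IsFirstIntegral ω (Ψ j)) ∧ InInvolution ω Ψ ∧
    level Γ E ⊆ closure (level Γ E ∩ regularSet Ψ)

/-- `Ψ` is real analytic on `TM`. -/
def IsAnalytic {Γ : Subgroup Nil} (Ψ : TM Γ → ℝ) : Prop :=
  ∀ u, AnalyticAt ℝ (pull Ψ) u

/-- `Ψ` is real analytic, as a function on `TM`, at all points of the energy level `E`. -/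
def IsAnalyticNearLevel {Γ : Subgroup Nil} (E : ℝ) (Ψ : TM Γ → ℝ) : Prop :=
  ∀ u, energy u = E → AnalyticAt ℝ (pull Ψ) u

/-- The restriction of `Ψ` to the energy level `E` is real analytic: near each point of the level
it coincides on the level with a real analytic function. -/
def IsAnalyticOnLevel {Γ : Subgroup Nil} (E : ℝ) (Ψ : TM Γ → ℝ) : Prop :=
  ∀ u, energy u = E → ∃ G : TN → ℝ, AnalyticAt ℝ G u ∧
    ∀ᶠ v in 𝓝 u, energy v = E → pull Ψ v = G v

/-! ### The explicit lattices and first integrals -/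

/-- The lattice `Span_ℤ (x₁ e₁, x₂ e₂, x₃ e₃, x₄ e₄)` of the Lie algebra. -/
def algLattice (x₁ x₂ x₃ x₄ : ℝ) : Submodule ℤ Alg :=
  Submodule.span ℤ {x₁ • e 0, x₂ • e 1, x₃ • e 2, x₄ • e 3}

/-- The functions `f₂, f₃, f₄` on `TN` (for `b = 0`), where `Iⱼ` is the function attached
to `eⱼ`. -/
def integralsF (ω : Form) (a c ρ : ℝ) : Fin 3 → TN → ℝ :=
  ![fun u =>
      if a ≠ 0 then momentum ω (e 1) u - 1 / (2 * a) * (momentum ω (e 2) u + ρ) ^ 2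
      else if momentum ω (e 2) u + ρ = 0 then 0
      else Real.exp (-1 / (momentum ω (e 2) u + ρ) ^ 2) *
        Real.sin (Real.pi * momentum ω (e 1) u / (momentum ω (e 2) u + ρ)),
    fun u => if a ≠ 0 then Real.sin (Real.pi / a * momentum ω (e 2) u) else momentum ω (e 2) u,
    fun u => if c ≠ 0 then Real.sin (Real.pi / c * momentum ω (e 3) u) else momentum ω (e 3) u]

/-- The functions `g₂, g₃, g₄` on `TN` (for `c = 0` and `b ≠ 0`). -/
def integralsG (ω : Form) (a b ρ : ℝ) : Fin 3 → TN → ℝ :=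
  ![fun u => b * momentum ω (e 0) u - a * momentum ω (e 1) u
      + (1 / 2 : ℝ) * (momentum ω (e 2) u + ρ) ^ 2,
    fun u => Real.sin (2 * Real.pi * momentum ω (e 2) u),
    fun u => momentum ω (e 3) u]

end KodairaThurston

end

/-!
In the left trivialisation of `TN` let `W` be the exponential coordinates of the base point and `V`
those of the fibre, both numbered from `1`. A direct computation of the functions `I₁, …, I₄` shows
that all the integrals have a simple form. For `b = 0`,
`I₃ = V₃ - a W₁`, `I₄ = V₄ - c W₁`, and `f₂ = V₂ - (V₃ + ρ)² / (2 a)` if `a ≠ 0`, while for `a = 0`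
`f₂ = exp (-1 / s²) sin (π V₂ / s - π W₁)` with `s = V₃ + ρ`. For `c = 0`,
`g₂ = b V₁ - a V₂ + (V₃ + ρ)² / 2`, `g₃ = sin (2 π (V₃ - a W₁ - b W₂))` and `g₄ = V₄`.

* Invariance under the lattice only concerns the shifts of `W₁` and `W₂`, which are additive; the
  lattices are subgroups because their generators satisfy `x₁ x₂ = 2 x₃`
  (`expLattice`, `isCocompactLattice_expLattice`).
* The magnetic equations are an explicit system in `W₁, W₂, V` (`IsMagneticTrajectory.hasDerivAt`),
  along which each function above has zero derivative.
* The twisted form is nondegenerate, and the bracket of functions of `W₁, W₂, V` is a bilinear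
  expression in their differentials (`poisson_eq`). For `b = 0` no differential involves `dV₁` or
  `dW₂`, and this expression vanishes identically; for `c = 0` it is a short check.
* The differentials of the energy and of the integrals are triangular for `b = 0`, and nearly so
  for `c = 0`. They are independent where `V` avoids one or two hyperplanes and some cosines do not
  vanish. On a sphere, hyperplanes are avoided by following great circles, and the cosines become
  nonzero when `W₁` or `W₂` is moved (`level_subset_closure_inter`).
* For `a = b = 0` smoothness of `f₂` follows from `contDiff_flatWave`: the derivatives of
  `s⁻ᵏ exp (-1 / s²) sin (π x / s + θ)` are combinations of functions of the same kind. An energy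
  level contains points with `s = 0` precisely when `E ≥ ρ² / 2`. Near such a point with
  `W₁ = -1 / 2`, `V₂ = 0`, the function `f₂` restricts to `exp (-1 / s²)` on a great circle along
  which `s` is analytic and not identically zero; this is flat but not zero, so it is not analytic
  (`eventually_eq_zero_of_analyticAt_exp`).
-/

open scoped InnerProductSpace Topology

noncomputable section

namespace KodairaThurston

/-! ### Coordinates on the tangent bundle -/

/-- The exponential coordinate `(exp W, V) ↦ W i` on `TN`, as a continuous linear form. -/
def baseCoord (i : Fin 4) : TN →L[ℝ] ℝ :=
  (EuclideanSpace.proj i : Alg →L[ℝ] ℝ).comp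
    ((logN : Nil →L[ℝ] Alg).comp (ContinuousLinearMap.fst ℝ Nil Alg))

/-- The fibre coordinate `(p, V) ↦ V i` on `TN`, as a continuous linear form. -/
def fibreCoord (i : Fin 4) : TN →L[ℝ] ℝ :=
  (EuclideanSpace.proj i : Alg →L[ℝ] ℝ).comp (ContinuousLinearMap.snd ℝ Nil Alg)

lemma baseCoord_apply (i : Fin 4) (u : TN) : baseCoord i u = logN u.1 i := rfl

lemma fibreCoord_apply (i : Fin 4) (u : TN) : fibreCoord i u = u.2 i := rfl

lemma inner_eq (X Y : Alg) : ⟪X, Y⟫_ℝ = X 0 * Y 0 + X 1 * Y 1 + X 2 * Y 2 + X 3 * Y 3 := by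
  simp [PiLp.inner_apply, Fin.sum_univ_four, mul_comm]

@[simp] lemma e_apply (i j : Fin 4) : e i j = if j = i then 1 else 0 := by
  simp [e]

lemma logN_mul (p q : Nil) :
    logN (p * q) = logN p + logN q + (1 / 2 : ℝ) • bracket (logN p) (logN q) := rfl

lemma logN_expN (X : Alg) : logN (expN X) = X := rfl

lemma maurerCartan_eq (p ξ : Nil) :
    maurerCartan p ξ = logN ξ - (1 / 2 : ℝ) • bracket (logN p) (logN ξ) := by
  have h : HasFDerivAt (fun q : Nil => logN (p⁻¹ * q))
      ((logN : Nil →L[ℝ] Alg) + (1 / 2 : ℝ) •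
        (bracket (-logN p)).toContinuousLinearMap.comp (logN : Nil →L[ℝ] Alg)) p := by
    have h1 := (logN : Nil →L[ℝ] Alg).hasFDerivAt (x := p)
    have h2 := ((bracket (-logN p)).toContinuousLinearMap.hasFDerivAt (x := logN p)).comp p h1
    exact (h1.const_add (-logN p)).add (h2.const_smul (1 / 2 : ℝ))
  rw [maurerCartan, h.fderiv]
  simp [sub_eq_add_neg]

lemma leftVec_eq (p : Nil) (V : Alg) :
    leftVec p V = expN (V + (1 / 2 : ℝ) • bracket (logN p) V) := by
  have h : HasFDerivAt (fun X : Alg => p * expN X)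
      ((expN : Alg →L[ℝ] Nil).comp (ContinuousLinearMap.id ℝ Alg + (1 / 2 : ℝ) •
        (bracket (logN p)).toContinuousLinearMap)) 0 := by
    have h1 := (ContinuousLinearMap.id ℝ Alg).hasFDerivAt (x := 0)
    have h2 := ((bracket (logN p)).toContinuousLinearMap.hasFDerivAt (x := 0))
    exact (expN : Alg →L[ℝ] Nil).hasFDerivAt.comp 0
      ((h1.const_add (logN p)).add (h2.const_smul (1 / 2 : ℝ)))
  rw [leftVec, h.fderiv]
  simp

lemma rightVec_eq (p : Nil) (V : Alg) :
    rightVec p V = expN (V + (1 / 2 : ℝ) • bracket V (logN p)) := by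
  have h : HasFDerivAt (fun X : Alg => expN X * p)
      ((expN : Alg →L[ℝ] Nil).comp (ContinuousLinearMap.id ℝ Alg + (1 / 2 : ℝ) •
        (bracket.flip (logN p)).toContinuousLinearMap)) 0 := by
    have h1 := (ContinuousLinearMap.id ℝ Alg).hasFDerivAt (x := 0)
    have h2 := ((bracket.flip (logN p)).toContinuousLinearMap.hasFDerivAt (x := 0))
    exact (expN : Alg →L[ℝ] Nil).hasFDerivAt.comp 0
      ((h1.add_const (logN p)).add (h2.const_smul (1 / 2 : ℝ)))
  rw [rightVec, h.fderiv]
  simp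

/-! ### The magnetic field and the functions attached to the basis -/

lemma magneticForm_apply (a b c ρ : ℝ) (X Y : Alg) :
    magneticForm a b c ρ X Y = a * (X 0 * Y 2 - X 2 * Y 0) + b * (X 1 * Y 2 - X 2 * Y 1)
      + c * (X 0 * Y 3 - X 3 * Y 0) + ρ * (X 0 * Y 1 - X 1 * Y 0) := by
  simp [magneticForm, wedge, dual_apply]

lemma lorentz_apply (ω : Form) (X : Alg) (i : Fin 4) : lorentz ω X i = ω X (e i) := by
  fin_cases i <;> simp [lorentz, Fin.sum_univ_four]

lemma momentum_zero (a b c ρ : ℝ) (u : TN) :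
    momentum (magneticForm a b c ρ) (e 0) u = fibreCoord 0 u + baseCoord 1 u * fibreCoord 2 u
      + a * baseCoord 2 u + c * baseCoord 3 u + ρ * baseCoord 1 u
      - 1 / 2 * baseCoord 1 u * (a * baseCoord 0 u + b * baseCoord 1 u) := by
  simp only [momentum, maurerCartan_eq, rightVec_eq, logN_expN, inner_eq, lorentz_apply,
    magneticForm_apply, bracket_apply, baseCoord_apply, fibreCoord_apply]
  simp
  ring

lemma momentum_one (a b c ρ : ℝ) (u : TN) :
    momentum (magneticForm a b c ρ) (e 1) u = fibreCoord 1 u - baseCoord 0 u * fibreCoord 2 u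
      + b * baseCoord 2 u - ρ * baseCoord 0 u
      + 1 / 2 * baseCoord 0 u * (a * baseCoord 0 u + b * baseCoord 1 u) := by
  simp only [momentum, maurerCartan_eq, rightVec_eq, logN_expN, inner_eq, lorentz_apply,
    magneticForm_apply, bracket_apply, baseCoord_apply, fibreCoord_apply]
  simp
  ring

lemma momentum_two (a b c ρ : ℝ) (u : TN) :
    momentum (magneticForm a b c ρ) (e 2) u
      = fibreCoord 2 u - (a * baseCoord 0 u + b * baseCoord 1 u) := by
  simp only [momentum, maurerCartan_eq, rightVec_eq, logN_expN, inner_eq, lorentz_apply,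
    magneticForm_apply, bracket_apply, baseCoord_apply, fibreCoord_apply]
  simp
  ring

lemma momentum_three (a b c ρ : ℝ) (u : TN) :
    momentum (magneticForm a b c ρ) (e 3) u = fibreCoord 3 u - c * baseCoord 0 u := by
  simp only [momentum, maurerCartan_eq, rightVec_eq, logN_expN, inner_eq, lorentz_apply,
    magneticForm_apply, bracket_apply, baseCoord_apply, fibreCoord_apply]
  simp
  ring

/-- The form `ρ de³` is a multiple of `e¹²`. -/
lemma smul_extDiff_dual_two (ρ : ℝ) : ρ • extDiff (dual 2) = magneticForm 0 0 0 (-ρ) := by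
  refine LinearMap.ext fun X => LinearMap.ext fun Y => ?_
  simp [magneticForm_apply, extDiff, bracket_apply, dual_apply]

/-- The Pfaffian of the magnetic form is `bc`, so that `F` is invertible when `bc ≠ 0`. -/
lemma mul_eq_zero_of_finrank_range {a b c ρ : ℝ}
    (h : Module.finrank ℝ (LinearMap.range (lorentz (magneticForm a b c ρ))) = 2) :
    b * c = 0 := by
  by_contra hbc
  obtain ⟨hb, hc⟩ := mul_ne_zero_iff.1 hbc
  have hinj : Function.Injective (lorentz (magneticForm a b c ρ)) := by
    rw [← LinearMap.ker_eq_bot, LinearMap.ker_eq_bot']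
    intro X hX
    have h' : ∀ i, magneticForm a b c ρ X (e i) = 0 := fun i => by
      rw [← lorentz_apply, hX]; rfl
    have h0 := h' 0
    have h1 := h' 1
    have h2 := h' 2
    have h3 := h' 3
    simp only [magneticForm_apply, e_apply] at h0 h1 h2 h3
    norm_num [Fin.ext_iff] at h0 h1 h2 h3
    have x0 : X 0 = 0 := h3.resolve_left hc
    rw [x0] at h1 h2
    have x1 : X 1 = 0 := by simpa [hb] using h2
    have x2 : X 2 = 0 := by simpa [hb] using h1
    rw [x1, x2] at h0
    have x3 : X 3 = 0 := by simpa [hc] using h0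
    ext i
    fin_cases i <;> simp [x0, x1, x2, x3]
  rw [LinearMap.finrank_range_of_inj hinj] at h
  simp at h

/-! ### Magnetic trajectories -/

/-- The equations of a magnetic trajectory in coordinates. -/
lemma IsMagneticTrajectory.hasDerivAt {a b c ρ ε : ℝ} {γ : ℝ → TN}
    (h : IsMagneticTrajectory (magneticForm a b c ρ) ε γ) {t : ℝ} (ht : t ∈ Set.Ioo (-ε) ε) :
    (HasDerivAt (fun s => baseCoord 0 (γ s)) (fibreCoord 0 (γ t)) t ∧
      HasDerivAt (fun s => baseCoord 1 (γ s)) (fibreCoord 1 (γ t)) t) ∧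
    HasDerivAt (fun s => fibreCoord 0 (γ s)) (-(a * fibreCoord 2 (γ t)) - c * fibreCoord 3 (γ t)
      - (ρ + fibreCoord 2 (γ t)) * fibreCoord 1 (γ t)) t ∧
    HasDerivAt (fun s => fibreCoord 1 (γ s)) (-(b * fibreCoord 2 (γ t))
      + (ρ + fibreCoord 2 (γ t)) * fibreCoord 0 (γ t)) t ∧
    HasDerivAt (fun s => fibreCoord 2 (γ s))
      (a * fibreCoord 0 (γ t) + b * fibreCoord 1 (γ t)) t ∧
    HasDerivAt (fun s => fibreCoord 3 (γ s)) (c * fibreCoord 0 (γ t)) t := by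
  obtain ⟨h1, h2⟩ := h t ht
  have hb : ∀ i, HasDerivAt (fun s => baseCoord i (γ s))
      (logN (leftVec (γ t).1 (γ t).2) i) t := fun i =>
    ((EuclideanSpace.proj i : Alg →L[ℝ] ℝ).comp
      (logN : Nil →L[ℝ] Alg)).hasFDerivAt.comp_hasDerivAt t h1
  have hf : ∀ i, HasDerivAt (fun s => fibreCoord i (γ s)) ((lorentz (magneticForm a b c ρ) (γ t).2
      - leviCivita (γ t).2 (γ t).2) i) t := fun i =>
    (EuclideanSpace.proj i : Alg →L[ℝ] ℝ).hasFDerivAt.comp_hasDerivAt t h2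
  refine ⟨⟨(hb 0).congr_deriv ?_, (hb 1).congr_deriv ?_⟩, (hf 0).congr_deriv ?_,
    (hf 1).congr_deriv ?_, (hf 2).congr_deriv ?_, (hf 3).congr_deriv ?_⟩
  · simp [leftVec_eq, logN_expN, bracket_apply, fibreCoord_apply]
  · simp [leftVec_eq, logN_expN, bracket_apply, fibreCoord_apply]
  all_goals
    simp [lorentz_apply, magneticForm_apply, leviCivita, Fin.sum_univ_four, inner_eq,
      bracket_apply, fibreCoord_apply]
    try ring

/-- A function with vanishing derivative along a curve is constant along it. -/
lemma eq_of_hasDerivAt_zero {ε : ℝ} {f : ℝ → ℝ}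
    (h : ∀ t ∈ Set.Ioo (-ε) ε, HasDerivAt f 0 t) {s t : ℝ} (hs : s ∈ Set.Ioo (-ε) ε)
    (ht : t ∈ Set.Ioo (-ε) ε) : f s = f t :=
  isOpen_Ioo.is_const_of_deriv_eq_zero isPreconnected_Ioo
    (fun x hx => (h x hx).differentiableAt.differentiableWithinAt)
    (fun x hx => (h x hx).deriv) hs ht

/-! ### The Poisson bracket -/

/-- The covector `α dW₁ + β dW₂ + y₀ dV₁ + y₁ dV₂ + y₂ dV₃ + y₃ dV₄` on `TN`, with coordinates
numbered from `1`. -/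
def covector (α β y₀ y₁ y₂ y₃ : ℝ) : TN →L[ℝ] ℝ :=
  α • baseCoord 0 + β • baseCoord 1 + y₀ • fibreCoord 0 + y₁ • fibreCoord 1 + y₂ • fibreCoord 2
    + y₃ • fibreCoord 3

lemma covector_apply (α β y₀ y₁ y₂ y₃ : ℝ) (U : TN) :
    covector α β y₀ y₁ y₂ y₃ U = α * logN U.1 0 + β * logN U.1 1 + y₀ * U.2 0 + y₁ * U.2 1
      + y₂ * U.2 2 + y₃ * U.2 3 := rfl

lemma taut_eq (u A : TN) :
    taut u A = logN A.1 0 * fibreCoord 0 u + logN A.1 1 * fibreCoord 1 u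
      + logN A.1 2 * fibreCoord 2 u + logN A.1 3 * fibreCoord 3 u
      - 1 / 2 * ((logN A.1 1 * baseCoord 0 u - logN A.1 0 * baseCoord 1 u)
        * fibreCoord 2 u) := by
  simp [taut, maurerCartan_eq, inner_eq, bracket_apply, baseCoord_apply, fibreCoord_apply]
  ring

lemma fderiv_taut (u A U : TN) :
    fderiv ℝ (fun v => taut v A) u U = logN A.1 0 * U.2 0 + logN A.1 1 * U.2 1
      + logN A.1 2 * U.2 2 + logN A.1 3 * U.2 3
      - 1 / 2 * ((logN A.1 1 * logN u.1 0 - logN A.1 0 * logN u.1 1) * U.2 2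
        + (logN A.1 1 * logN U.1 0 - logN A.1 0 * logN U.1 1) * u.2 2) := by
  have hb : ∀ i, HasFDerivAt (fun v => baseCoord i v) (baseCoord i) u :=
    fun i => (baseCoord i).hasFDerivAt
  have hf : ∀ i, HasFDerivAt (fun v => fibreCoord i v) (fibreCoord i) u :=
    fun i => (fibreCoord i).hasFDerivAt
  have h := (((((hf 0).const_mul (logN A.1 0)).add ((hf 1).const_mul (logN A.1 1))).add
    ((hf 2).const_mul (logN A.1 2))).add ((hf 3).const_mul (logN A.1 3))).sub
    (((((hb 0).const_mul (logN A.1 1)).sub ((hb 1).const_mul (logN A.1 0))).mul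
      (hf 2)).const_mul (1 / 2))
  have h' := h.congr_of_eventuallyEq (f₁ := fun v => taut v A)
    (Filter.Eventually.of_forall fun v => taut_eq v A)
  rw [h'.fderiv]
  simp [baseCoord_apply, fibreCoord_apply]
  ring

/-- The twisted form in the left trivialisation: for `X, Y` the left-translated base components,
it is `⟨X, B⟩ - ⟨Y, A⟩ + ⟨[X, Y], V⟩ + ω (X, Y)`. -/
lemma twistedForm_eq (ω : Form) (u A B : TN) :
    twistedForm ω u A B = ⟪maurerCartan u.1 A.1, B.2⟫_ℝ - ⟪maurerCartan u.1 B.1, A.2⟫_ℝ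
      + ⟪bracket (maurerCartan u.1 A.1) (maurerCartan u.1 B.1), u.2⟫_ℝ
      + ω (maurerCartan u.1 A.1) (maurerCartan u.1 B.1) := by
  simp only [twistedForm, dTaut, fderiv_taut, maurerCartan_eq, inner_eq, bracket_apply]
  simp
  ring

lemma maurerCartan_leftVec (p : Nil) (X : Alg) : maurerCartan p (leftVec p X) = X := by
  rw [maurerCartan_eq, leftVec_eq, logN_expN]
  simp only [bracket_apply]
  ext i
  fin_cases i <;> simp

lemma logN_leftVec_zero (p : Nil) (X : Alg) : logN (leftVec p X) 0 = X 0 := by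
  simp [leftVec_eq, logN_expN, bracket_apply]

lemma logN_leftVec_one (p : Nil) (X : Alg) : logN (leftVec p X) 1 = X 1 := by
  simp [leftVec_eq, logN_expN, bracket_apply]

lemma logN_eq_maurerCartan_zero (p ξ : Nil) : logN ξ 0 = maurerCartan p ξ 0 := by
  simp [maurerCartan_eq, bracket_apply]

lemma logN_eq_maurerCartan_one (p ξ : Nil) : logN ξ 1 = maurerCartan p ξ 1 := by
  simp [maurerCartan_eq, bracket_apply]

/-- The Hamiltonian vector of a function whose differential is a given covector. -/
def hamiltonianVector (a b c ρ α β y₀ y₁ y₂ y₃ : ℝ) (u : TN) : TN :=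
  (leftVec u.1 !₂[y₀, y₁, y₂, y₃],
    !₂[-(u.2 2 + ρ) * y₁ - a * y₂ - c * y₃ - α, (u.2 2 + ρ) * y₀ - b * y₂ - β,
      a * y₀ + b * y₁, c * y₀])

lemma isHamiltonianVector_hamiltonianVector {a b c ρ α β y₀ y₁ y₂ y₃ : ℝ} {φ : TN → ℝ} {u : TN}
    (h : HasFDerivAt φ (covector α β y₀ y₁ y₂ y₃) u) :
    IsHamiltonianVector (magneticForm a b c ρ) φ u
      (hamiltonianVector a b c ρ α β y₀ y₁ y₂ y₃ u) := by
  intro U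
  rw [h.fderiv, twistedForm_eq, covector_apply, hamiltonianVector, maurerCartan_leftVec,
    logN_eq_maurerCartan_zero u.1, logN_eq_maurerCartan_one u.1]
  simp [inner_eq, bracket_apply, magneticForm_apply]
  ring

/-- The twisted form is nondegenerate, so that Hamiltonian vectors are unique. -/
lemma eq_hamiltonianVector {a b c ρ α β y₀ y₁ y₂ y₃ : ℝ} {φ : TN → ℝ} {u X : TN}
    (h : HasFDerivAt φ (covector α β y₀ y₁ y₂ y₃) u)
    (hX : IsHamiltonianVector (magneticForm a b c ρ) φ u X) :
    maurerCartan u.1 X.1 = !₂[y₀, y₁, y₂, y₃] ∧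
      X.2 = (hamiltonianVector a b c ρ α β y₀ y₁ y₂ y₃ u).2 := by
  have hm : maurerCartan u.1 X.1 = !₂[y₀, y₁, y₂, y₃] := by
    ext i
    have := hX (0, e i)
    rw [h.fderiv, twistedForm_eq, covector_apply] at this
    fin_cases i <;>
      simpa [maurerCartan_eq, inner_eq, bracket_apply, magneticForm_apply] using this
  refine ⟨hm, ?_⟩
  ext i
  have := hX (leftVec u.1 (e i), 0)
  rw [h.fderiv, twistedForm_eq, covector_apply, maurerCartan_leftVec, hm,
    logN_leftVec_zero, logN_leftVec_one] at this
  fin_cases i <;>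
  · simp [inner_eq, bracket_apply, magneticForm_apply] at this
    simp [hamiltonianVector]
    linarith

/-- The Poisson bracket of two functions whose differentials involve only `dW₁`, `dW₂` on the
base. -/
lemma poisson_eq {a b c ρ α β y₀ y₁ y₂ y₃ α' β' z₀ z₁ z₂ z₃ : ℝ} {φ ψ : TN → ℝ} {u : TN}
    (hφ : HasFDerivAt φ (covector α β y₀ y₁ y₂ y₃) u)
    (hψ : HasFDerivAt ψ (covector α' β' z₀ z₁ z₂ z₃) u) :
    poisson (magneticForm a b c ρ) φ ψ u = α * z₀ + β * z₁ - α' * y₀ - β' * y₁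
      + (u.2 2 + ρ) * (z₀ * y₁ - z₁ * y₀) + a * (z₀ * y₂ - z₂ * y₀) + b * (z₁ * y₂ - z₂ * y₁)
      + c * (z₀ * y₃ - z₃ * y₀) := by
  have h1 := Classical.epsilon_spec (p := IsHamiltonianVector (magneticForm a b c ρ) φ u)
    ⟨_, isHamiltonianVector_hamiltonianVector hφ⟩
  have h2 := Classical.epsilon_spec (p := IsHamiltonianVector (magneticForm a b c ρ) ψ u)
    ⟨_, isHamiltonianVector_hamiltonianVector hψ⟩
  obtain ⟨h3, h4⟩ := eq_hamiltonianVector hψ h2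
  rw [poisson, hamiltonianField, hamiltonianField, h1, hφ.fderiv, covector_apply,
    logN_eq_maurerCartan_zero u.1, logN_eq_maurerCartan_one u.1, h3, h4]
  simp [hamiltonianVector]
  ring

/-! ### Flat oscillating functions -/

lemma exp_neg_one_div_sq_le {s : ℝ} (hs : s ≠ 0) (m : ℕ) :
    Real.exp (-1 / s ^ 2) ≤ m.factorial * s ^ (2 * m) := by
  have h := Real.pow_div_factorial_le_exp (1 / s ^ 2) (by positivity) m
  have h2 : 0 < (1 / s ^ 2) ^ m / (m.factorial : ℝ) := by positivity
  rw [neg_div, Real.exp_neg]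
  refine (inv_anti₀ h2 h).trans_eq ?_
  rw [inv_div, one_div, inv_pow, div_inv_eq_mul, pow_mul]

/-- The function `s⁻ᵏ exp (-1 / s²) sin (π x / s + θ)` of `(x, s)`, extended by `0` to `s = 0`.
The family is closed under taking partial derivatives, up to polynomial factors in `x`; the phase
`θ` takes care of the cosines. -/
def flatWave (k : ℕ) (θ : ℝ) (z : ℝ × ℝ) : ℝ :=
  if z.2 = 0 then 0 else z.2⁻¹ ^ k * Real.exp (-1 / z.2 ^ 2) * Real.sin (Real.pi * z.1 / z.2 + θ)

lemma flatWave_of_eq {k : ℕ} {θ : ℝ} {z : ℝ × ℝ} (h : z.2 = 0) : flatWave k θ z = 0 := if_pos h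

lemma flatWave_of_ne {k : ℕ} {θ : ℝ} {z : ℝ × ℝ} (h : z.2 ≠ 0) : flatWave k θ z =
    z.2⁻¹ ^ k * Real.exp (-1 / z.2 ^ 2) * Real.sin (Real.pi * z.1 / z.2 + θ) := if_neg h

lemma abs_flatWave_le (k : ℕ) (θ : ℝ) (z : ℝ × ℝ) :
    |flatWave k θ z| ≤ (k + 1).factorial * |z.2| ^ (k + 2) := by
  by_cases h : z.2 = 0
  · rw [flatWave_of_eq h]
    simp only [abs_zero]
    positivity
  · have h1 := exp_neg_one_div_sq_le h (k + 1)
    rw [flatWave_of_ne h, abs_mul, abs_mul, Real.abs_exp, abs_pow, abs_inv]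
    have hz : 0 < |z.2| := abs_pos.2 h
    calc |z.2|⁻¹ ^ k * Real.exp (-1 / z.2 ^ 2) * |Real.sin (Real.pi * z.1 / z.2 + θ)|
        ≤ |z.2|⁻¹ ^ k * ((k + 1).factorial * z.2 ^ (2 * (k + 1))) * 1 := by
          refine mul_le_mul ?_ (Real.abs_sin_le_one _) (abs_nonneg _) ?_
          · gcongr
          · exact mul_nonneg (by positivity) ((Real.exp_pos _).le.trans h1)
      _ = |z.2|⁻¹ ^ k * ((k + 1).factorial * |z.2| ^ (2 * (k + 1))) * 1 := by
          rw [pow_mul, pow_mul, sq_abs]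
      _ = (k + 1).factorial * |z.2| ^ (k + 2) := by
          have hk : |z.2|⁻¹ ^ k * |z.2| ^ k = 1 := by
            rw [← mul_pow, inv_mul_cancel₀ hz.ne', one_pow]
          linear_combination ((k + 1).factorial * |z.2| ^ (k + 2) : ℝ) * hk

lemma hasFDerivAt_flatWave (k : ℕ) (θ : ℝ) (z : ℝ × ℝ) :
    HasFDerivAt (flatWave k θ)
      ((Real.pi * flatWave (k + 1) (θ + Real.pi / 2) z) • ContinuousLinearMap.fst ℝ ℝ ℝ
        + (-(k * flatWave (k + 1) θ z) + 2 * flatWave (k + 3) θ z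
          - Real.pi * z.1 * flatWave (k + 2) (θ + Real.pi / 2) z)
            • ContinuousLinearMap.snd ℝ ℝ ℝ) z := by
  by_cases h : z.2 = 0
  -- At `s = 0` the proposed derivative is zero, and the function is `O (|s| ^ (k + 2))`.
  · simp only [flatWave_of_eq h, mul_zero, neg_zero, add_zero, sub_zero, zero_smul]
    refine Asymptotics.IsBigO.hasFDerivAt (n := k + 2) ?_ (by omega)
    refine Asymptotics.IsBigO.of_bound ((k + 1).factorial : ℝ) (Filter.Eventually.of_forall ?_)
    intro y
    rw [Real.norm_eq_abs, norm_pow, norm_norm]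
    refine (abs_flatWave_le k θ y).trans ?_
    gcongr
    have : y.2 = (y - z).2 := by simp [h]
    rw [this]
    exact norm_snd_le (y - z)
  · have h1 : HasFDerivAt (fun y : ℝ × ℝ => y.1) (ContinuousLinearMap.fst ℝ ℝ ℝ) z :=
      hasFDerivAt_fst
    have h2 : HasFDerivAt (fun y : ℝ × ℝ => y.2) (ContinuousLinearMap.snd ℝ ℝ ℝ) z :=
      hasFDerivAt_snd
    have hi : HasFDerivAt (fun y : ℝ × ℝ => y.2⁻¹)
        ((-(z.2 ^ 2)⁻¹) • ContinuousLinearMap.snd ℝ ℝ ℝ) z :=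
      (hasDerivAt_inv h).comp_hasFDerivAt z h2
    have hA := hi.pow k
    have hB := ((hi.pow 2).const_mul (-1)).exp
    have hC := (((h1.const_mul Real.pi).mul hi).add_const θ).sin
    have hD := (hA.mul hB).mul hC
    have hev : ∀ᶠ y in 𝓝 z, y.2 ≠ 0 := continuous_snd.continuousAt.eventually_ne h
    have hE := hD.congr_of_eventuallyEq (f₁ := flatWave k θ) (by
      filter_upwards [hev] with y hy
      rw [flatWave_of_ne hy]
      simp only [div_eq_mul_inv, inv_pow, Pi.mul_apply])
    refine hE.congr_fderiv ?_
    simp only [flatWave_of_ne h, ← add_assoc, Real.sin_add_pi_div_two]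
    refine ContinuousLinearMap.ext fun y => ?_
    simp only [div_eq_mul_inv]
    have hk : (k : ℝ) * (z.2⁻¹) ^ (k - 1) * (z.2 ^ 2)⁻¹ = k * z.2⁻¹ ^ (k + 1) := by
      rcases k with _ | k
      · simp
      · simp
        field_simp
        ring
    simp [-inv_pow]
    simp [pow_succ] at hk ⊢
    linear_combination (-(y.2) * Real.exp (-(z.2⁻¹ * z.2⁻¹))
      * Real.sin (Real.pi * z.1 * z.2⁻¹ + θ)) * hk

lemma contDiff_flatWave_nat (n : ℕ) : ∀ (k : ℕ) (θ : ℝ), ContDiff ℝ n (flatWave k θ) := by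
  induction n with
  | zero =>
    intro k θ
    exact contDiff_zero.2 (continuous_iff_continuousAt.2 fun z =>
      (hasFDerivAt_flatWave k θ z).continuousAt)
  | succ n ih =>
    intro k θ
    refine contDiff_succ_iff_hasFDerivAt.2 ⟨_, ?_, hasFDerivAt_flatWave k θ⟩
    exact ((contDiff_const.mul (ih _ _)).smul contDiff_const).add
      ((((contDiff_const.mul (ih _ _)).neg.add (contDiff_const.mul (ih _ _))).sub
        ((contDiff_const.mul contDiff_fst).mul (ih _ _))).smul contDiff_const)

lemma contDiff_flatWave (k : ℕ) (θ : ℝ) : ContDiff ℝ (⊤ : ℕ∞) (flatWave k θ) :=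
  contDiff_infty.2 fun n => contDiff_flatWave_nat n k θ

lemma analyticAt_flatWave (k : ℕ) (θ : ℝ) {z : ℝ × ℝ} (h : z.2 ≠ 0) :
    AnalyticAt ℝ (flatWave k θ) z := by
  have hi : AnalyticAt ℝ (fun y : ℝ × ℝ => y.2⁻¹) z := analyticAt_snd.inv h
  have : AnalyticAt ℝ (fun y : ℝ × ℝ => y.2⁻¹ ^ k * Real.exp (-1 * y.2⁻¹ ^ 2)
      * Real.sin (Real.pi * y.1 * y.2⁻¹ + θ)) z := by
    have hs : AnalyticAt ℝ (fun y : ℝ × ℝ => Real.pi * y.1 * y.2⁻¹ + θ) z :=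
      ((analyticAt_const.mul analyticAt_fst).mul hi).add analyticAt_const
    have he : AnalyticAt ℝ (fun y : ℝ × ℝ => -1 * y.2⁻¹ ^ 2) z :=
      analyticAt_const.mul (hi.pow 2)
    exact ((hi.pow k).mul he.rexp').mul (Real.analyticAt_sin.fun_comp hs)
  refine this.congr ?_
  filter_upwards [continuous_snd.continuousAt.eventually_ne h] with y hy
  rw [flatWave_of_ne hy]
  simp only [div_eq_mul_inv, inv_pow]

/-- If `s` is analytic and vanishes at `0`, then `exp (-1 / s²)` vanishes there to infinite order;
so it can only be analytic if `s` is identically zero near `0`. -/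
lemma eventually_eq_zero_of_analyticAt_exp {g s : ℝ → ℝ} (hg : AnalyticAt ℝ g 0)
    (hs : AnalyticAt ℝ s 0) (hs0 : s 0 = 0)
    (h : ∀ᶠ t in 𝓝 0, g t = if s t = 0 then 0 else Real.exp (-1 / s t ^ 2)) :
    ∀ᶠ t in 𝓝 0, s t = 0 := by
  by_cases hz : ∀ᶠ t in 𝓝 0, g t = 0
  · filter_upwards [h, hz] with t h1 h2
    by_contra h3
    rw [if_neg h3, h2] at h1
    exact (Real.exp_pos _).ne h1
  exfalso
  -- Otherwise `g t = t ^ n * r t` with `r 0 ≠ 0`, whereas `g t = O (t ^ (2 * n + 2))`.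
  obtain ⟨n, r, hr, hr0, hgr⟩ := hg.exists_eventuallyEq_pow_smul_nonzero_iff.2 hz
  apply hr0
  obtain ⟨C, hC⟩ := (hs.differentiableAt.isBigO_sub).bound
  have hb : ∀ᶠ t in 𝓝[≠] (0 : ℝ),
      |r t| ≤ (n + 1).factorial * C ^ (2 * (n + 1)) * |t| ^ (n + 2) := by
    filter_upwards [nhdsWithin_le_nhds h, nhdsWithin_le_nhds hgr, nhdsWithin_le_nhds hC,
      self_mem_nhdsWithin] with t h1 h2 h3 (ht : t ≠ 0)
    simp only [hs0, sub_zero, Real.norm_eq_abs, smul_eq_mul] at h2 h3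
    have hle : |g t| ≤ (n + 1).factorial * |s t| ^ (2 * (n + 1)) := by
      rw [h1]
      split_ifs with h0
      · simp only [abs_zero]
        positivity
      · rw [Real.abs_exp, pow_mul, sq_abs, ← pow_mul]
        exact exp_neg_one_div_sq_le h0 _
    have hp : 0 < |t| ^ n := pow_pos (abs_pos.2 ht) n
    rw [h2, abs_mul, abs_pow] at hle
    have h4 : |s t| ^ (2 * (n + 1)) ≤ (C * |t|) ^ (2 * (n + 1)) := by gcongr
    refine le_of_mul_le_mul_left ?_ hp
    calc |t| ^ n * |r t| ≤ (n + 1).factorial * (C * |t|) ^ (2 * (n + 1)) :=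
          hle.trans (by gcongr)
      _ = _ := by ring
  have h1 : Filter.Tendsto (fun t => |r t|) (𝓝[≠] (0 : ℝ)) (𝓝 |r 0|) :=
    (hr.continuousAt.tendsto.mono_left nhdsWithin_le_nhds).abs
  have h2 : Filter.Tendsto (fun t : ℝ =>
      ((n + 1).factorial : ℝ) * C ^ (2 * (n + 1)) * |t| ^ (n + 2)) (𝓝[≠] (0 : ℝ)) (𝓝 0) := by
    have : Continuous (fun t : ℝ =>
      ((n + 1).factorial : ℝ) * C ^ (2 * (n + 1)) * |t| ^ (n + 2)) := by fun_prop
    have h3 := (this.tendsto 0).mono_left (nhdsWithin_le_nhds (s := {0}ᶜ))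
    simpa using h3
  exact abs_nonpos_iff.1 (le_of_tendsto_of_tendsto h1 h2 hb)

/-! ### The lattices -/

lemma mem_algLattice {x₁ x₂ x₃ x₄ : ℝ} {X : Alg} : X ∈ algLattice x₁ x₂ x₃ x₄ ↔
    ∃ k₁ k₂ k₃ k₄ : ℤ, X 0 = k₁ * x₁ ∧ X 1 = k₂ * x₂ ∧ X 2 = k₃ * x₃ ∧ X 3 = k₄ * x₄ := by
  simp only [algLattice, Submodule.mem_span_insert, Submodule.mem_span_singleton]
  constructor
  · rintro ⟨k₁, _, ⟨k₂, _, ⟨k₃, _, ⟨k₄, rfl⟩, rfl⟩, rfl⟩, rfl⟩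
    exact ⟨k₁, k₂, k₃, k₄, by simp, by simp, by simp, by simp⟩
  · rintro ⟨k₁, k₂, k₃, k₄, h₁, h₂, h₃, h₄⟩
    refine ⟨k₁, _, ⟨k₂, _, ⟨k₃, _, ⟨k₄, rfl⟩, rfl⟩, rfl⟩, ?_⟩
    ext i
    fin_cases i <;> simp [h₁, h₂, h₃, h₄]

/-- The exponential of a lattice with `x₁ x₂ = 2 x₃` is a subgroup, because the correction terms
`[X, Y] / 2` of the Baker–Campbell–Hausdorff formula stay in the lattice. -/
def expLattice (x₁ x₂ x₃ x₄ : ℝ) (h : x₁ * x₂ = 2 * x₃) : Subgroup Nil where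
  carrier := expN '' (algLattice x₁ x₂ x₃ x₄ : Set Alg)
  one_mem' := ⟨0, zero_mem _, rfl⟩
  inv_mem' := by
    rintro _ ⟨X, hX, rfl⟩
    exact ⟨-X, neg_mem hX, rfl⟩
  mul_mem' := by
    rintro _ _ ⟨X, hX, rfl⟩ ⟨Y, hY, rfl⟩
    refine ⟨_, ?_, (expN_mul_expN X Y).symm⟩
    obtain ⟨k₁, k₂, k₃, k₄, h₁, h₂, h₃, h₄⟩ := mem_algLattice.1 hX
    obtain ⟨l₁, l₂, l₃, l₄, g₁, g₂, g₃, g₄⟩ := mem_algLattice.1 hY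
    refine mem_algLattice.2 ⟨k₁ + l₁, k₂ + l₂, k₃ + l₃ + (k₁ * l₂ - k₂ * l₁), k₄ + l₄, ?_⟩
    simp [bracket_apply, h₁, h₂, h₃, h₄, g₁, g₂, g₃, g₄]
    refine ⟨by ring, by ring, ?_, by ring⟩
    linear_combination (1 / 2 * (k₁ * l₂ - k₂ * l₁) : ℝ) * h

lemma mem_expLattice {x₁ x₂ x₃ x₄ : ℝ} {h : x₁ * x₂ = 2 * x₃} {p : Nil} :
    p ∈ expLattice x₁ x₂ x₃ x₄ h ↔ logN p ∈ algLattice x₁ x₂ x₃ x₄ :=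
  ⟨fun ⟨_, hX, hp⟩ => hp ▸ hX, fun hp => ⟨_, hp, rfl⟩⟩

lemma eq_of_abs_sub_lt {x y z : ℝ} {k l : ℤ} (hy : y = k * x) (hz : z = l * x)
    (h : |y - z| < |x|) : y = z := by
  have hx : 0 < |x| := (abs_nonneg _).trans_lt h
  rw [hy, hz, ← sub_mul, abs_mul] at h
  have h1 : |((k - l : ℤ) : ℝ)| < 1 := by
    push_cast
    nlinarith
  rw [← Int.cast_abs] at h1
  have h2 : |k - l| < 1 := by exact_mod_cast h1
  rw [hy, hz, sub_eq_zero.1 (Int.abs_lt_one_iff.1 h2)]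

lemma exists_int_add_mem_uIcc {x : ℝ} (hx : x ≠ 0) (y : ℝ) :
    ∃ k : ℤ, k * x + y ∈ Set.uIcc 0 x := by
  refine ⟨-⌊y / x⌋, ?_⟩
  have h : ((-⌊y / x⌋ : ℤ) : ℝ) * x + y = Int.fract (y / x) * x := by
    rw [Int.fract]
    push_cast
    field_simp
    ring
  rw [h]
  have h0 := Int.fract_nonneg (y / x)
  have h1 := (Int.fract_lt_one (y / x)).le
  rcases lt_or_gt_of_ne hx with hx | hx
  · exact Set.mem_uIcc.2 (Or.inr ⟨by nlinarith, by nlinarith⟩)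
  · exact Set.mem_uIcc.2 (Or.inl ⟨by nlinarith, by nlinarith⟩)

lemma isCocompactLattice_expLattice {x₁ x₂ x₃ x₄ : ℝ} (h : x₁ * x₂ = 2 * x₃) (h₁ : x₁ ≠ 0)
    (h₂ : x₂ ≠ 0) (h₄ : x₄ ≠ 0) : IsCocompactLattice (expLattice x₁ x₂ x₃ x₄ h) := by
  have h₃ : x₃ ≠ 0 := by
    rintro rfl
    simp [h₁, h₂] at h
  constructor
  · change DiscreteTopology ((expLattice x₁ x₂ x₃ x₄ h : Set Nil) : Set Nil)
    rw [discreteTopology_subtype_iff']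
    intro p hp
    refine ⟨{q | |logN q 0 - logN p 0| < |x₁|} ∩ {q | |logN q 1 - logN p 1| < |x₂|} ∩
      {q | |logN q 2 - logN p 2| < |x₃|} ∩ {q | |logN q 3 - logN p 3| < |x₄|}, ?_, ?_⟩
    · have hc : ∀ i, Continuous fun q : Nil => logN q i := fun i =>
        (EuclideanSpace.proj i : Alg →L[ℝ] ℝ).continuous.comp logN.continuous
      have ho : ∀ (i : Fin 4) (r : ℝ), IsOpen {q | |logN q i - logN p i| < r} := fun i r =>
        isOpen_lt ((hc i).sub continuous_const).abs continuous_const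
      exact (((ho _ _).inter (ho _ _)).inter (ho _ _)).inter (ho _ _)
    · ext q
      constructor
      · rintro ⟨⟨⟨⟨h0, h1⟩, h2⟩, h3⟩, hq⟩
        obtain ⟨k₁, k₂, k₃, k₄, e₁, e₂, e₃, e₄⟩ := mem_algLattice.1 (mem_expLattice.1 hp)
        obtain ⟨l₁, l₂, l₃, l₄, g₁, g₂, g₃, g₄⟩ := mem_algLattice.1 (mem_expLattice.1 hq)
        refine logN.injective (PiLp.ext fun i => ?_)
        fin_cases i
        · exact eq_of_abs_sub_lt g₁ e₁ h0
        · exact eq_of_abs_sub_lt g₂ e₂ h1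
        · exact eq_of_abs_sub_lt g₃ e₃ h2
        · exact eq_of_abs_sub_lt g₄ e₄ h3
      · rintro rfl
        exact ⟨⟨⟨⟨by simpa, by simpa⟩, by simpa⟩, by simpa⟩, hp⟩
  · -- The compact box `∏ [0, xᵢ]` meets every orbit.
    have hK : IsCompact ((fun v : Fin 4 → ℝ => expN (WithLp.toLp 2 v)) ''
        Set.univ.pi fun i => Set.uIcc 0 (![x₁, x₂, x₃, x₄] i)) :=
      (isCompact_univ_pi fun i => isCompact_uIcc).image
        (expN.continuous.comp (PiLp.continuous_toLp 2 _))
    have hq := hK.image (f := (Quotient.mk _ : Nil → Quo (expLattice x₁ x₂ x₃ x₄ h)))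
      continuous_quotient_mk'
    refine ⟨hq.of_isClosed_subset isClosed_univ ?_⟩
    rintro ⟨p⟩ -
    obtain ⟨k₁, hk₁⟩ := exists_int_add_mem_uIcc h₁ (logN p 0)
    obtain ⟨k₂, hk₂⟩ := exists_int_add_mem_uIcc h₂ (logN p 1)
    obtain ⟨k₃, hk₃⟩ := exists_int_add_mem_uIcc h₃
      (logN p 2 + 1 / 2 * (k₁ * x₁ * logN p 1 - k₂ * x₂ * logN p 0))
    obtain ⟨k₄, hk₄⟩ := exists_int_add_mem_uIcc h₄ (logN p 3)
    set γ : Nil := expN !₂[k₁ * x₁, k₂ * x₂, k₃ * x₃, k₄ * x₄] with hγ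
    have hγm : γ ∈ expLattice x₁ x₂ x₃ x₄ h :=
      mem_expLattice.2 (mem_algLattice.2 ⟨k₁, k₂, k₃, k₄, rfl, rfl, rfl, rfl⟩)
    refine ⟨γ * p, ⟨fun i => logN (γ * p) i, ?_, rfl⟩, ?_⟩
    · intro i _
      fin_cases i
      · simpa [logN_mul, bracket_apply, hγ, logN_expN] using hk₁
      · simpa [logN_mul, bracket_apply, hγ, logN_expN] using hk₂
      · simpa [logN_mul, bracket_apply, hγ, logN_expN, add_assoc] using hk₃
      · simpa [logN_mul, bracket_apply, hγ, logN_expN] using hk₄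
    · refine Quotient.sound (s := QuotientGroup.rightRel _) ?_
      change QuotientGroup.rightRel _ _ _
      rw [QuotientGroup.rightRel_apply]
      simpa using inv_mem hγm

/-- A function on `TN` that is invariant under left translations by `Γ` descends to `TM`. -/
lemma exists_pull_eq {Γ : Subgroup Nil} {F : TN → ℝ}
    (h : ∀ γ ∈ Γ, ∀ p V, F (γ * p, V) = F (p, V)) : ∃ Ψ : TM Γ → ℝ, pull Ψ = F := by
  refine ⟨fun v => Quotient.lift (fun p => F (p, v.2)) (fun p q hpq => ?_) v.1, rfl⟩
  have hm : q * p⁻¹ ∈ Γ := by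
    rw [← QuotientGroup.rightRel_apply]
    exact hpq
  have := h _ hm p v.2
  rw [inv_mul_cancel_right] at this
  exact this.symm

/-! ### Density on energy levels -/

/-- A sphere minus an affine hyperplane is dense in the sphere: follow a great circle which is
not contained in the hyperplane. -/
lemma dense_setOf_inner_ne {E : ℝ} (hE : 0 < E) {m : Alg} (hm : m ≠ 0) (k : ℝ) :
    Dense {V : {V : Alg // 1 / 2 * ⟪V, V⟫_ℝ = E} | ⟪m, V.1⟫_ℝ ≠ k} := by
  rintro ⟨V, hV⟩
  by_cases hk : ⟪m, V⟫_ℝ = k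
  swap
  · exact subset_closure hk
  -- On the great circle through `V` and `W` the form `⟪m, ·⟫` is `k cos t + ⟪m, W⟫ sin t`, which
  -- is constant only if `k` and `⟪m, W⟫` both vanish. For `k = 0` take `W` proportional to `m`; for
  -- `k ≠ 0` any `W` orthogonal to `V` will do.
  obtain ⟨W, hVW, hWW, hmW⟩ : ∃ W : Alg, ⟪V, W⟫_ℝ = 0 ∧ ⟪W, W⟫_ℝ = ⟪V, V⟫_ℝ ∧
      (k = 0 → ⟪m, W⟫_ℝ ≠ 0) := by
    by_cases hk0 : k = 0
    · have hm' : ⟪m, m⟫_ℝ ≠ 0 := inner_self_ne_zero.2 hm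
      have hV0 : V ≠ 0 := by
        rintro rfl
        simp at hV
        exact hE.ne hV
      refine ⟨(‖V‖ / ‖m‖) • m, ?_, ?_, fun _ => ?_⟩
      · rw [inner_smul_right, real_inner_comm, hk, hk0, mul_zero]
      · rw [inner_smul_left, inner_smul_right, real_inner_self_eq_norm_sq,
          real_inner_self_eq_norm_sq]
        have := norm_ne_zero_iff.2 hm
        simp
        field_simp
      · rw [inner_smul_right]
        exact mul_ne_zero (div_ne_zero (norm_ne_zero_iff.2 hV0) (norm_ne_zero_iff.2 hm)) hm'
    · refine ⟨!₂[-V 1, V 0, -V 3, V 2], ?_, ?_, fun h => absurd h hk0⟩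
      · rw [inner_eq]
        simp
        ring
      · rw [inner_eq, inner_eq]
        simp
        ring
  let γ : ℝ → {V : Alg // 1 / 2 * ⟪V, V⟫_ℝ = E} := fun t =>
    ⟨Real.cos t • V + Real.sin t • W, by
      simp only [inner_add_left, inner_add_right, inner_smul_left, inner_smul_right,
        real_inner_comm V W, hVW, hWW]
      simp only [conj_trivial, mul_zero, add_zero, zero_add]
      rw [← hV]
      linear_combination (1 / 2 * ⟪V, V⟫_ℝ) * Real.sin_sq_add_cos_sq t⟩
  have hγ : Continuous γ := by
    refine Continuous.subtype_mk ?_ _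
    fun_prop
  have hγ0 : γ 0 = ⟨V, hV⟩ := by
    ext1
    simp [γ]
  have hf : ∀ t, ⟪m, (γ t).1⟫_ℝ = Real.cos t * k + Real.sin t * ⟪m, W⟫_ℝ := fun t => by
    simp [γ, inner_add_right, inner_smul_right, hk]
  have hfreq : ∃ᶠ t in 𝓝 (0 : ℝ), ⟪m, (γ t).1⟫_ℝ ≠ k := by
    intro hev
    have hA : AnalyticOnNhd ℝ (fun t => Real.cos t * k + Real.sin t * ⟪m, W⟫_ℝ) Set.univ :=
      fun t _ => (Real.analyticAt_cos.mul analyticAt_const).add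
        (Real.analyticAt_sin.mul analyticAt_const)
    have hB : AnalyticOnNhd ℝ (fun _ : ℝ => k) Set.univ := fun t _ => analyticAt_const
    have heq := hA.eq_of_eventuallyEq hB (z₀ := 0) (by
      filter_upwards [hev] with t ht
      rw [← hf]
      exact not_not.1 ht)
    have h1 := congrFun heq Real.pi
    have h2 := congrFun heq (Real.pi / 2)
    simp at h1 h2
    have hk0 : k = 0 := by linarith
    exact hmW hk0 (h2.trans hk0)
  rw [← hγ0]
  exact mem_closure_of_frequently_of_tendsto hfreq hγ.continuousAt.tendsto

/-- To approximate a point of an energy level by points of a set `R` within the level, one may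
first make the velocity avoid two hyperplanes, and then move the base point along a line. -/
lemma level_subset_closure_inter {E : ℝ} (hE : 0 < E) {m m' : Alg} (hm : m ≠ 0) (hm' : m' ≠ 0)
    (k k' : ℝ) (d : Nil) {R : Set TN} (hR : ∀ (p : Nil) (V : Alg), ⟪m, V⟫_ℝ ≠ k →
      ⟪m', V⟫_ℝ ≠ k' → ∀ᶠ t : ℝ in 𝓝[≠] 0, (p + t • d, V) ∈ R) :
    {u | energy u = E} ⊆ closure ({u | energy u = E} ∩ R) := by
  have hd : Dense {V : {V : Alg // 1 / 2 * ⟪V, V⟫_ℝ = E} | ⟪m, V.1⟫_ℝ ≠ k ∧ ⟪m', V.1⟫_ℝ ≠ k'} :=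
    (dense_setOf_inner_ne hE hm k).inter_of_isOpen_left (dense_setOf_inner_ne hE hm' k')
      (isOpen_ne_fun (by fun_prop) continuous_const)
  rintro ⟨p, V⟩ hu
  have hclosed : IsClosed {V : {V : Alg // 1 / 2 * ⟪V, V⟫_ℝ = E} |
      (p, V.1) ∈ closure ({u | energy u = E} ∩ R)} :=
    isClosed_closure.preimage (continuous_const.prodMk continuous_subtype_val)
  have hsub : {V : {V : Alg // 1 / 2 * ⟪V, V⟫_ℝ = E} | ⟪m, V.1⟫_ℝ ≠ k ∧ ⟪m', V.1⟫_ℝ ≠ k'} ⊆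
      {V | (p, V.1) ∈ closure ({u | energy u = E} ∩ R)} := ?_
  · have h := hclosed.closure_subset_iff.2 hsub
    rw [hd.closure_eq] at h
    exact h (Set.mem_univ (⟨V, hu⟩ : {V : Alg // 1 / 2 * ⟪V, V⟫_ℝ = E}))
  · rintro ⟨V, hV⟩ ⟨h1, h2⟩
    have hc : Continuous fun t : ℝ => ((p + t • d, V) : TN) := by fun_prop
    have ht := (hc.tendsto 0).mono_left (nhdsWithin_le_nhds (s := {0}ᶜ))
    simp only [zero_smul, add_zero] at ht
    refine mem_closure_of_tendsto ht ?_
    filter_upwards [hR p V h1 h2] with t ht'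
    exact ⟨hV, ht'⟩

lemma dense_setOf_energy_pos : Dense {u : TN | 0 < energy u} := by
  rintro ⟨p, V⟩
  have hpos : ∀ W : Alg, W ≠ 0 → 0 < energy ((p, W) : TN) := fun W hW => by
    have := real_inner_self_pos.2 hW
    simp only [energy]
    positivity
  by_cases hV : V = 0
  · have hc : Continuous fun t : ℝ => ((p, V + t • e 0) : TN) := by fun_prop
    have ht := (hc.tendsto 0).mono_left (nhdsWithin_le_nhds (s := {0}ᶜ))
    simp only [zero_smul, add_zero] at ht
    refine mem_closure_of_tendsto ht ?_
    filter_upwards [self_mem_nhdsWithin] with t ht'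
    refine hpos _ fun h => ht' ?_
    have := congrArg (fun W : Alg => W 0) h
    simpa [hV] using this
  · exact subset_closure (hpos V hV)

lemma continuous_proj (Γ : Subgroup Nil) : Continuous (proj Γ) :=
  (continuous_quotient_mk'.comp continuous_fst).prodMk continuous_snd

lemma proj_surjective (Γ : Subgroup Nil) : Function.Surjective (proj Γ) := by
  rintro ⟨⟨p⟩, V⟩
  exact ⟨(p, V), rfl⟩

/-- Complete integrability, with and without restriction to an energy level, from the density of
the regular points upstairs in each positive energy level. -/
lemma completelyIntegrableBy_of_closure {ω : Form} {Γ : Subgroup Nil} {Ψ : Fin 3 → TM Γ → ℝ}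
    (h1 : ∀ j, IsFirstIntegral ω (Ψ j)) (h2 : InInvolution ω Ψ)
    (h3 : ∀ E, 0 < E → {u | energy u = E} ⊆ closure ({u | energy u = E} ∩
      {u | LinearIndependent ℝ ![fderiv ℝ energy u, fderiv ℝ (pull (Ψ 0)) u,
        fderiv ℝ (pull (Ψ 1)) u, fderiv ℝ (pull (Ψ 2)) u]})) :
    CompletelyIntegrableBy ω Ψ ∧ ∀ E : ℝ, 0 < E → CompletelyIntegrableAtLevelBy ω E Ψ := by
  refine ⟨⟨h1, h2, ?_⟩, fun E hE => ⟨h1, h2, ?_⟩⟩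
  · refine (proj_surjective Γ).denseRange.dense_image (continuous_proj Γ) ?_
    refine dense_closure.1 (dense_setOf_energy_pos.mono fun u hu => ?_)
    exact closure_mono Set.inter_subset_right (h3 _ hu rfl)
  · refine (Set.image_mono (h3 E hE)).trans
      ((image_closure_subset_closure_image (continuous_proj Γ)).trans (closure_mono ?_))
    exact Set.image_inter_subset _ _ _

/-! ### Linear independence of the differentials -/

lemma hasFDerivAt_energy (u : TN) :
    HasFDerivAt energy (covector 0 0 (u.2 0) (u.2 1) (u.2 2) (u.2 3)) u := by
  have hf : ∀ i, HasFDerivAt (fun v => fibreCoord i v) (fibreCoord i) u :=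
    fun i => (fibreCoord i).hasFDerivAt
  have h := (((((hf 0).pow 2).add ((hf 1).pow 2)).add ((hf 2).pow 2)).add
    ((hf 3).pow 2)).const_mul (1 / 2)
  refine (h.congr_of_eventuallyEq (f₁ := energy) (Filter.Eventually.of_forall
    fun v => ?_)).congr_fderiv (ContinuousLinearMap.ext fun U => ?_)
  · rw [energy, inner_eq]
    simp [fibreCoord_apply]
    ring
  · simp [covector_apply, fibreCoord_apply]
    ring

/-- Triangular differentials are independent. -/
lemma linearIndependent_of_triangular {v₀ v₁ v₂ v₃ α k y α' k' α'' k'' : ℝ} (h₀ : v₀ ≠ 0)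
    (h₁ : k ≠ 0) (h₂ : k' ≠ 0) (h₃ : k'' ≠ 0) :
    LinearIndependent ℝ ![covector 0 0 v₀ v₁ v₂ v₃, covector α 0 0 k y 0, covector α' 0 0 0 k' 0,
      covector α'' 0 0 0 0 k''] := by
  rw [Fintype.linearIndependent_iff]
  intro g hg
  have hv : ∀ i : Fin 4, (∑ j, g j • ![covector 0 0 v₀ v₁ v₂ v₃, covector α 0 0 k y 0,
      covector α' 0 0 0 k' 0, covector α'' 0 0 0 0 k''] j) (0, e i) = 0 := fun i => by rw [hg]; rfl
  have e0 := hv 0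
  have e1 := hv 1
  have e2 := hv 2
  have e3 := hv 3
  simp [Fin.sum_univ_four, covector_apply, h₀] at e0
  simp [Fin.sum_univ_four, covector_apply, e0, h₁] at e1
  simp [Fin.sum_univ_four, covector_apply, e0, e1, h₂] at e2
  simp [Fin.sum_univ_four, covector_apply, e0, e1, e2, h₃] at e3
  intro i
  fin_cases i <;> assumption

/-- Of the four covectors only the third involves `dW₂`; the others are independent when the minor
`a v₀ + b v₁` in `dV₁, dV₂` does not vanish. -/
lemma linearIndependent_of_mul_add_mul_ne_zero {v₀ v₁ v₂ v₃ a b y k : ℝ} (hb : b ≠ 0)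
    (hk : k ≠ 0) (hv : a * v₀ + b * v₁ ≠ 0) :
    LinearIndependent ℝ ![covector 0 0 v₀ v₁ v₂ v₃, covector 0 0 b (-a) y 0,
      covector (-(a * k)) (-(b * k)) 0 0 k 0, covector 0 0 0 0 0 1] := by
  rw [Fintype.linearIndependent_iff]
  intro g hg
  have h : ∀ U : TN, (∑ j, g j • ![covector 0 0 v₀ v₁ v₂ v₃, covector 0 0 b (-a) y 0,
      covector (-(a * k)) (-(b * k)) 0 0 k 0, covector 0 0 0 0 0 1] j) U = 0 :=
    fun U => by rw [hg]; rfl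
  have e2 := h (expN (e 1), 0)
  have e0 := h (0, e 0)
  have e1 := h (0, e 1)
  have e3 := h (0, e 3)
  simp [Fin.sum_univ_four, covector_apply, logN_expN, hb, hk] at e0 e1 e2 e3
  have g0 : g 0 = 0 := by
    have : g 0 * (a * v₀ + b * v₁) = 0 := by linear_combination a * e0 + b * e1
    exact (mul_eq_zero.1 this).resolve_right hv
  have g1 : g 1 = 0 := by simpa [g0, hb] using e0
  have g3 : g 3 = 0 := by simpa [g0] using e3
  intro i
  fin_cases i <;> assumption

lemma eventually_cos_add_mul_ne_zero (A : ℝ) {c : ℝ} (hc : c ≠ 0) :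
    ∀ᶠ t : ℝ in 𝓝[≠] 0, Real.cos (A + c * t) ≠ 0 := by
  by_cases h : Real.cos A = 0
  · have h1 : HasDerivAt (fun t : ℝ => Real.cos (A + c * t)) (-Real.sin A * c) 0 := by
      have := (((hasDerivAt_id (0 : ℝ)).const_mul c).const_add A).cos
      simpa using this
    refine h1.eventually_ne (mul_ne_zero (neg_ne_zero.2 fun h2 => ?_) hc)
    have := Real.sin_sq_add_cos_sq A
    simp [h, h2] at this
  · have h1 : Continuous fun t : ℝ => Real.cos (A + c * t) := by fun_prop
    exact nhdsWithin_le_nhds (h1.continuousAt.eventually_ne (by simpa using h))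

/-! ### The first integrals for `b = 0` -/

/-- The function `sin (π x / a)`, of period `2 a`, or `x` itself if `a = 0`. -/
def periodize (a x : ℝ) : ℝ := if a ≠ 0 then Real.sin (Real.pi / a * x) else x

/-- The derivative of `periodize a`. -/
def periodizeDeriv (a x : ℝ) : ℝ :=
  if a ≠ 0 then Real.cos (Real.pi / a * x) * (Real.pi / a) else 1

lemma hasDerivAt_periodize (a x : ℝ) : HasDerivAt (periodize a) (periodizeDeriv a x) x := by
  by_cases ha : a = 0
  · have : periodize a = id := by
      funext x
      simp [periodize, ha]
    rw [this]
    simpa [periodizeDeriv, ha] using hasDerivAt_id x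
  · have : periodize a = fun x => Real.sin (Real.pi / a * x) := by
      funext x
      simp [periodize, ha]
    rw [this]
    simpa [periodizeDeriv, ha] using ((hasDerivAt_id x).const_mul (Real.pi / a)).sin

lemma analyticAt_periodize (a x : ℝ) : AnalyticAt ℝ (periodize a) x := by
  by_cases ha : a = 0
  · have : periodize a = id := by
      funext x
      simp [periodize, ha]
    rw [this]
    exact analyticAt_id
  · have : periodize a = fun x => Real.sin (Real.pi / a * x) := by
      funext x
      simp [periodize, ha]
    rw [this]
    exact Real.analyticAt_sin.fun_comp (analyticAt_const.mul analyticAt_id)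

lemma periodize_sub (a x : ℝ) (k : ℤ) : periodize a (x - a * (k * 2)) = periodize a x := by
  by_cases ha : a = 0
  · simp [periodize, ha]
  · have : Real.pi / a * (x - a * (k * 2)) = Real.pi / a * x - k * (2 * Real.pi) := by
      field_simp
    simp only [periodize, this, Real.sin_sub_int_mul_two_pi, ne_eq, ha, not_false_iff, if_true]

lemma eventually_periodizeDeriv_ne_zero (a x : ℝ) :
    ∀ᶠ t : ℝ in 𝓝[≠] 0, periodizeDeriv a (x - a * t) ≠ 0 := by
  by_cases ha : a = 0
  · simp [periodizeDeriv, ha]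
  · filter_upwards [eventually_cos_add_mul_ne_zero (Real.pi / a * x)
      (neg_ne_zero.2 Real.pi_ne_zero)] with t ht
    have : Real.pi / a * (x - a * t) = Real.pi / a * x + -Real.pi * t := by
      field_simp
      ring
    simp only [periodizeDeriv, ne_eq, ha, not_false_iff, if_true, this]
    exact mul_ne_zero ht (div_ne_zero Real.pi_ne_zero ha)

/-- The periodised function `Vᵢ - a W₁`; for `b = 0` these are the integrals `f₃` and `f₄`. -/
def shearIntegral (i : Fin 4) (a : ℝ) (u : TN) : ℝ :=
  periodize a (fibreCoord i u - a * baseCoord 0 u)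

lemma analyticAt_baseCoord (i : Fin 4) (u : TN) : AnalyticAt ℝ (fun v => baseCoord i v) u :=
  (baseCoord i).analyticAt u

lemma analyticAt_fibreCoord (i : Fin 4) (u : TN) : AnalyticAt ℝ (fun v => fibreCoord i v) u :=
  (fibreCoord i).analyticAt u

lemma analyticAt_shearIntegral (i : Fin 4) (a : ℝ) (u : TN) :
    AnalyticAt ℝ (shearIntegral i a) u :=
  (analyticAt_periodize a _).fun_comp
    ((analyticAt_fibreCoord i u).sub (analyticAt_const.mul (analyticAt_baseCoord 0 u)))

lemma contDiff_of_analyticAt {F : TN → ℝ} (h : ∀ u, AnalyticAt ℝ F u) :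
    ContDiff ℝ (⊤ : ℕ∞) F := contDiff_iff_contDiffAt.2 fun u => (h u).contDiffAt

lemma hasFDerivAt_shearIntegral (i : Fin 4) (a : ℝ) (u : TN) :
    HasFDerivAt (shearIntegral i a)
      (periodizeDeriv a (fibreCoord i u - a * baseCoord 0 u) •
        (fibreCoord i - a • baseCoord 0)) u :=
  (hasDerivAt_periodize a _).comp_hasFDerivAt u
    ((fibreCoord i).hasFDerivAt.sub ((baseCoord 0).hasFDerivAt.const_mul a))

/-- The function `V₂ - (V₃ + ρ)² / (2 a)`, replaced for `a = 0` by the flat oscillating function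
of `V₂ - (V₃ + ρ) W₁` and `V₃ + ρ`; for `b = 0` this is the integral `f₂`. -/
def waveIntegral (a ρ : ℝ) (u : TN) : ℝ :=
  if a ≠ 0 then fibreCoord 1 u - 1 / (2 * a) * (fibreCoord 2 u + ρ) ^ 2
  else flatWave 0 0 (fibreCoord 1 u - baseCoord 0 u * (fibreCoord 2 u + ρ), fibreCoord 2 u + ρ)

lemma waveIntegral_of_ne {a : ℝ} (ha : a ≠ 0) (ρ : ℝ) : waveIntegral a ρ =
    fun u => fibreCoord 1 u - 1 / (2 * a) * (fibreCoord 2 u + ρ) ^ 2 := by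
  funext u
  exact if_pos ha

lemma waveIntegral_zero (ρ : ℝ) : waveIntegral 0 ρ = fun u =>
    flatWave 0 0 (fibreCoord 1 u - baseCoord 0 u * (fibreCoord 2 u + ρ), fibreCoord 2 u + ρ) := by
  funext u
  simp [waveIntegral]

/-- The derivative of `waveIntegral` in the direction of `V₂`. -/
def waveCoeff (a ρ : ℝ) (u : TN) : ℝ :=
  if a ≠ 0 then 1 else Real.pi * flatWave 1 (Real.pi / 2)
    (fibreCoord 1 u - baseCoord 0 u * (fibreCoord 2 u + ρ), fibreCoord 2 u + ρ)

lemma analyticAt_waveIntegral_of_ne {a : ℝ} (ha : a ≠ 0) (ρ : ℝ) (u : TN) :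
    AnalyticAt ℝ (waveIntegral a ρ) u := by
  rw [waveIntegral_of_ne ha]
  exact (analyticAt_fibreCoord 1 u).sub (analyticAt_const.mul
    (((analyticAt_fibreCoord 2 u).add analyticAt_const).pow 2))

lemma analyticAt_waveIntegral_zero {ρ : ℝ} {u : TN} (hu : fibreCoord 2 u + ρ ≠ 0) :
    AnalyticAt ℝ (waveIntegral 0 ρ) u := by
  rw [waveIntegral_zero]
  have h2 : AnalyticAt ℝ (fun v => fibreCoord 2 v + ρ) u :=
    (analyticAt_fibreCoord 2 u).add analyticAt_const
  have h1 : AnalyticAt ℝ (fun v => fibreCoord 1 v - baseCoord 0 v * (fibreCoord 2 v + ρ)) u :=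
    (analyticAt_fibreCoord 1 u).sub ((analyticAt_baseCoord 0 u).mul h2)
  exact AnalyticAt.fun_comp (g := flatWave 0 0) (f := fun v =>
    (fibreCoord 1 v - baseCoord 0 v * (fibreCoord 2 v + ρ), fibreCoord 2 v + ρ))
    (analyticAt_flatWave 0 0 hu) (h1.prod h2)

lemma contDiff_waveIntegral (a ρ : ℝ) : ContDiff ℝ (⊤ : ℕ∞) (waveIntegral a ρ) := by
  by_cases ha : a = 0
  · subst ha
    rw [waveIntegral_zero]
    have hb : ContDiff ℝ (⊤ : ℕ∞) fun v => baseCoord 0 v := (baseCoord 0).contDiff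
    have hf : ∀ i, ContDiff ℝ (⊤ : ℕ∞) fun v => fibreCoord i v := fun i => (fibreCoord i).contDiff
    exact (contDiff_flatWave 0 0).comp
      (((hf 1).sub (hb.mul ((hf 2).add contDiff_const))).prodMk ((hf 2).add contDiff_const))
  · exact contDiff_of_analyticAt (analyticAt_waveIntegral_of_ne ha ρ)

lemma hasFDerivAt_waveIntegral (a ρ : ℝ) (u : TN) : ∃ α y,
    HasFDerivAt (waveIntegral a ρ) (covector α 0 0 (waveCoeff a ρ u) y 0) u := by
  have hb : HasFDerivAt (fun v => baseCoord 0 v) (baseCoord 0) u := (baseCoord 0).hasFDerivAt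
  have hf : ∀ i, HasFDerivAt (fun v => fibreCoord i v) (fibreCoord i) u :=
    fun i => (fibreCoord i).hasFDerivAt
  have h2 : HasFDerivAt (fun v => fibreCoord 2 v + ρ) (fibreCoord 2) u := (hf 2).add_const ρ
  by_cases ha : a = 0
  · subst ha
    rw [waveIntegral_zero]
    obtain ⟨B, hB⟩ : ∃ B, HasFDerivAt (flatWave 0 0) (waveCoeff 0 ρ u •
        ContinuousLinearMap.fst ℝ ℝ ℝ + B • ContinuousLinearMap.snd ℝ ℝ ℝ)
        (fibreCoord 1 u - baseCoord 0 u * (fibreCoord 2 u + ρ), fibreCoord 2 u + ρ) := by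
      have h := hasFDerivAt_flatWave 0 0
        (fibreCoord 1 u - baseCoord 0 u * (fibreCoord 2 u + ρ), fibreCoord 2 u + ρ)
      rw [zero_add, zero_add] at h
      have hk : waveCoeff 0 ρ u = Real.pi * flatWave 1 (Real.pi / 2)
          (fibreCoord 1 u - baseCoord 0 u * (fibreCoord 2 u + ρ), fibreCoord 2 u + ρ) := by
        simp [waveCoeff]
      rw [hk]
      exact ⟨_, h⟩
    have h := hB.comp u (((hf 1).sub (hb.mul h2)).prodMk h2)
    refine ⟨-(waveCoeff 0 ρ u * (fibreCoord 2 u + ρ)), B - waveCoeff 0 ρ u * baseCoord 0 u,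
      h.congr_fderiv (ContinuousLinearMap.ext fun U => ?_)⟩
    simp [covector]
    ring
  · rw [waveIntegral_of_ne ha]
    refine ⟨0, -(1 / a * (fibreCoord 2 u + ρ)),
      ((hf 1).sub ((h2.pow 2).const_mul (1 / (2 * a)))).congr_fderiv
        (ContinuousLinearMap.ext fun U => ?_)⟩
    simp [covector, waveCoeff, ha]
    field_simp
    ring

lemma baseCoord_add_smul (i j : Fin 4) (p : Nil) (V : Alg) (t : ℝ) :
    baseCoord i ((p + t • expN (e j), V) : TN) = logN p i + if i = j then t else 0 := by
  simp [baseCoord_apply, logN_expN]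

lemma eventually_waveCoeff_ne_zero (a : ℝ) {ρ : ℝ} (p : Nil) {V : Alg} (hV : V 2 + ρ ≠ 0) :
    ∀ᶠ t : ℝ in 𝓝[≠] 0, waveCoeff a ρ (p + t • expN (e 0), V) ≠ 0 := by
  by_cases ha : a = 0
  · filter_upwards [eventually_cos_add_mul_ne_zero
      (Real.pi * (V 1 - logN p 0 * (V 2 + ρ)) / (V 2 + ρ)) (neg_ne_zero.2 Real.pi_ne_zero)]
      with t ht
    have h1 : waveCoeff a ρ (p + t • expN (e 0), V) = Real.pi * flatWave 1 (Real.pi / 2)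
        (V 1 - (logN p 0 + t) * (V 2 + ρ), V 2 + ρ) := by
      simp only [waveCoeff, ha, baseCoord_add_smul, fibreCoord_apply]
      simp
    have h2 : Real.pi * (V 1 - (logN p 0 + t) * (V 2 + ρ)) / (V 2 + ρ)
        = Real.pi * (V 1 - logN p 0 * (V 2 + ρ)) / (V 2 + ρ) + -Real.pi * t := by
      field_simp
      ring
    rw [h1, flatWave_of_ne hV, Real.sin_add_pi_div_two, h2]
    have := Real.exp_ne_zero (-1 / (V 2 + ρ) ^ 2)
    have := Real.pi_ne_zero
    simp only [ne_eq, mul_eq_zero, not_or]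
    exact ⟨this, ⟨by simpa using hV, by assumption⟩, ht⟩
  · simp [waveCoeff, ha]

lemma integralsF_eq (a c ρ : ℝ) : integralsF (magneticForm a 0 c ρ) a c ρ =
    ![waveIntegral a ρ, shearIntegral 2 a, shearIntegral 3 c] := by
  funext j u
  fin_cases j
  · by_cases ha : a = 0
    · subst ha
      by_cases hs : fibreCoord 2 u + ρ = 0
      · simp [integralsF, waveIntegral, momentum_two, hs, flatWave_of_eq]
      · simp [integralsF, waveIntegral, momentum_two, momentum_one, hs, flatWave_of_ne]
        exact congrArg _ (by ring)
    · rw [waveIntegral_of_ne ha]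
      simp [integralsF, momentum_two, momentum_one, ha]
      field_simp
      ring
  · simp [integralsF, shearIntegral, periodize, momentum_two]
  · simp [integralsF, shearIntegral, periodize, momentum_three]

lemma shearIntegral_invariant (i : Fin 4) (a : ℝ) {γ : Nil} {k : ℤ} (hγ : logN γ 0 = k * 2)
    (p : Nil) (V : Alg) : shearIntegral i a (γ * p, V) = shearIntegral i a (p, V) := by
  have h : V i - a * logN (γ * p) 0 = V i - a * logN p 0 - a * (k * 2) := by
    rw [logN_mul]
    simp [bracket_apply, hγ]
    ring
  simp only [shearIntegral, fibreCoord_apply, baseCoord_apply, h, periodize_sub]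

lemma waveIntegral_invariant (a ρ : ℝ) {γ : Nil} {k : ℤ} (hγ : logN γ 0 = k * 2)
    (p : Nil) (V : Alg) : waveIntegral a ρ (γ * p, V) = waveIntegral a ρ (p, V) := by
  have h : logN (γ * p) 0 = k * 2 + logN p 0 := by
    rw [logN_mul]
    simp [bracket_apply, hγ]
  simp only [waveIntegral, fibreCoord_apply, baseCoord_apply, h]
  by_cases hs : V 2 + ρ = 0
  · simp [flatWave_of_eq, hs]
  · have h2 : Real.pi * (V 1 - (k * 2 + logN p 0) * (V 2 + ρ)) / (V 2 + ρ) + 0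
        = Real.pi * (V 1 - logN p 0 * (V 2 + ρ)) / (V 2 + ρ) + 0 - k * (2 * Real.pi) := by
      field_simp
      ring
    simp only [flatWave_of_ne, ne_eq, hs, not_false_iff, h2, Real.sin_sub_int_mul_two_pi]

section Trajectories

variable {a c ρ ε : ℝ} {γ : ℝ → TN} {s t : ℝ}

lemma fibreCoord_two_sub_eq (h : IsMagneticTrajectory (magneticForm a 0 c ρ) ε γ)
    (hs : s ∈ Set.Ioo (-ε) ε) (ht : t ∈ Set.Ioo (-ε) ε) :
    fibreCoord 2 (γ s) - a * baseCoord 0 (γ s) = fibreCoord 2 (γ t) - a * baseCoord 0 (γ t) := by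
  refine eq_of_hasDerivAt_zero (f := fun r => fibreCoord 2 (γ r) - a * baseCoord 0 (γ r))
    (fun r hr => ?_) hs ht
  obtain ⟨⟨hb, -⟩, -, -, h2, -⟩ := h.hasDerivAt hr
  exact (h2.sub (hb.const_mul a)).congr_deriv (by ring)

lemma fibreCoord_three_sub_eq (h : IsMagneticTrajectory (magneticForm a 0 c ρ) ε γ)
    (hs : s ∈ Set.Ioo (-ε) ε) (ht : t ∈ Set.Ioo (-ε) ε) :
    fibreCoord 3 (γ s) - c * baseCoord 0 (γ s) = fibreCoord 3 (γ t) - c * baseCoord 0 (γ t) := by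
  refine eq_of_hasDerivAt_zero (f := fun r => fibreCoord 3 (γ r) - c * baseCoord 0 (γ r))
    (fun r hr => ?_) hs ht
  obtain ⟨⟨hb, -⟩, -, -, -, h3⟩ := h.hasDerivAt hr
  exact (h3.sub (hb.const_mul c)).congr_deriv (by ring)

lemma waveIntegral_eq (h : IsMagneticTrajectory (magneticForm a 0 c ρ) ε γ)
    (hs : s ∈ Set.Ioo (-ε) ε) (ht : t ∈ Set.Ioo (-ε) ε) :
    waveIntegral a ρ (γ s) = waveIntegral a ρ (γ t) := by
  by_cases ha : a = 0
  · subst ha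
    have h2 : fibreCoord 2 (γ s) = fibreCoord 2 (γ t) := by
      simpa using fibreCoord_two_sub_eq h hs ht
    have h1 : fibreCoord 1 (γ s) - baseCoord 0 (γ s) * (fibreCoord 2 (γ s) + ρ)
        = fibreCoord 1 (γ t) - baseCoord 0 (γ t) * (fibreCoord 2 (γ t) + ρ) := by
      refine eq_of_hasDerivAt_zero
        (f := fun r => fibreCoord 1 (γ r) - baseCoord 0 (γ r) * (fibreCoord 2 (γ r) + ρ))
        (fun r hr => ?_) hs ht
      obtain ⟨⟨hb, -⟩, -, h1, h2, -⟩ := h.hasDerivAt hr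
      exact (h1.sub (hb.mul (h2.add_const ρ))).congr_deriv (by ring)
    simp only [waveIntegral_zero, h1]
    rw [h2]
  · simp only [waveIntegral_of_ne ha]
    refine eq_of_hasDerivAt_zero
      (f := fun r => fibreCoord 1 (γ r) - 1 / (2 * a) * (fibreCoord 2 (γ r) + ρ) ^ 2)
      (fun r hr => ?_) hs ht
    obtain ⟨-, -, h1, h2, -⟩ := h.hasDerivAt hr
    refine (h1.sub (((h2.add_const ρ).pow 2).const_mul (1 / (2 * a)))).congr_deriv ?_
    simp
    field_simp
    ring

end Trajectories

/-! ### Failure of analyticity for `a = b = 0` -/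

/-- Along an analytic curve on which `V₂ = 0` and `W₁ = -1 / 2`, the wave integral is
`exp (-1 / (V₃ + ρ)²)`. -/
lemma eventually_eq_zero_of_analyticAt_waveIntegral {ρ : ℝ} {A B : Alg} {G : TN → ℝ}
    {x y : ℝ → ℝ} (hx : AnalyticAt ℝ x 0) (hy : AnalyticAt ℝ y 0) (hA : A 1 = 0) (hB : B 1 = 0)
    (h0 : x 0 * A 2 + y 0 * B 2 + ρ = 0)
    (hG : AnalyticAt ℝ G (expN (-(1 / 2 : ℝ) • e 0), x 0 • A + y 0 • B))
    (h : ∀ᶠ t in 𝓝 0, waveIntegral 0 ρ (expN (-(1 / 2 : ℝ) • e 0), x t • A + y t • B)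
      = G (expN (-(1 / 2 : ℝ) • e 0), x t • A + y t • B)) :
    ∀ᶠ t in 𝓝 0, x t * A 2 + y t * B 2 + ρ = 0 := by
  have hγ : AnalyticAt ℝ (fun t : ℝ =>
      ((expN (-(1 / 2 : ℝ) • e 0), x t • A + y t • B) : TN)) 0 :=
    analyticAt_const.prod ((hx.smul analyticAt_const).add (hy.smul analyticAt_const))
  refine eventually_eq_zero_of_analyticAt_exp (AnalyticAt.fun_comp (g := G) (f := fun t : ℝ =>
      ((expN (-(1 / 2 : ℝ) • e 0), x t • A + y t • B) : TN)) hG hγ)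
    (((hx.mul analyticAt_const).add (hy.mul analyticAt_const)).add analyticAt_const) h0 ?_
  filter_upwards [h] with t ht
  have hW : waveIntegral 0 ρ (expN (-(1 / 2 : ℝ) • e 0), x t • A + y t • B)
      = flatWave 0 0 (1 / 2 * (x t * A 2 + y t * B 2 + ρ), x t * A 2 + y t * B 2 + ρ) := by
    simp [waveIntegral_zero, fibreCoord_apply, baseCoord_apply, logN_expN, hA, hB]
  rw [← ht, hW]
  by_cases hs : x t * A 2 + y t * B 2 + ρ = 0
  · rw [if_pos hs, flatWave_of_eq hs]
  · rw [if_neg hs, flatWave_of_ne hs]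
    have : Real.pi * (1 / 2 * (x t * A 2 + y t * B 2 + ρ)) / (x t * A 2 + y t * B 2 + ρ)
        = Real.pi / 2 := by
      field_simp
    simp only [this, add_zero, Real.sin_pi_div_two, pow_zero, one_mul, mul_one]

lemma not_isAnalyticOnLevel {Γ : Subgroup Nil} {Ψ : TM Γ → ℝ} {E ρ : ℝ}
    (hΨ : pull Ψ = waveIntegral 0 ρ) (hE : 0 < E) (hρ : ρ ^ 2 / 2 ≤ E) :
    ¬ IsAnalyticOnLevel E Ψ := by
  intro hΨE
  set v := Real.sqrt (2 * E - ρ ^ 2) with hv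
  have hv2 : v ^ 2 = 2 * E - ρ ^ 2 := Real.sq_sqrt (by linarith)
  -- A great circle in the plane of `V₁` and `V₃` through a point with `V₃ = -ρ`.
  set A : Alg := !₂[v, 0, -ρ, 0] with hA
  set B : Alg := !₂[ρ, 0, v, 0] with hB
  have hen : ∀ (p : Nil) (t : ℝ), energy ((p, Real.cos t • A + Real.sin t • B) : TN) = E := by
    intro p t
    rw [energy, inner_eq]
    simp [hA, hB]
    have := Real.sin_sq_add_cos_sq t
    linear_combination (1 / 2 * (Real.sin t ^ 2 + Real.cos t ^ 2)) * hv2 + E * this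
  obtain ⟨G, hG, hGev⟩ := hΨE (expN (-(1 / 2 : ℝ) • e 0), Real.cos 0 • A + Real.sin 0 • B)
    (hen _ 0)
  have hγ : Continuous fun t : ℝ =>
      ((expN (-(1 / 2 : ℝ) • e 0), Real.cos t • A + Real.sin t • B) : TN) := by fun_prop
  have hz := eventually_eq_zero_of_analyticAt_waveIntegral (ρ := ρ) (A := A) (B := B)
    Real.analyticAt_cos Real.analyticAt_sin rfl rfl (by simp [hA]) hG (by
      filter_upwards [hγ.continuousAt.eventually hGev] with t ht
      rw [← hΨ]
      exact ht (hen _ t))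
  have hs : AnalyticOnNhd ℝ (fun t => Real.cos t * A 2 + Real.sin t * B 2 + ρ) Set.univ :=
    fun t _ => ((Real.analyticAt_cos.mul analyticAt_const).add
      (Real.analyticAt_sin.mul analyticAt_const)).add analyticAt_const
  have h0 := hs.eq_of_eventuallyEq (fun _ _ => analyticAt_const) hz
  have h1 := congrFun h0 Real.pi
  have h2 := congrFun h0 (Real.pi / 2)
  simp [hA, hB] at h1 h2
  have hρ0 : ρ = 0 := by linarith
  have hv0 : v = 0 := by linarith
  rw [hv0, hρ0] at hv2
  linarith

lemma IsAnalyticNearLevel.isAnalyticOnLevel {Γ : Subgroup Nil} {Ψ : TM Γ → ℝ} {E : ℝ}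
    (h : IsAnalyticNearLevel E Ψ) : IsAnalyticOnLevel E Ψ :=
  fun u hu => ⟨pull Ψ, h u hu, Filter.Eventually.of_forall fun _ _ => rfl⟩

lemma not_isAnalyticNearLevel {Γ : Subgroup Nil} {Ψ : TM Γ → ℝ} {E ρ : ℝ}
    (hΨ : pull Ψ = waveIntegral 0 ρ) (hρ : ρ ^ 2 / 2 ≤ E) : ¬ IsAnalyticNearLevel E Ψ := by
  intro h
  rcases (show 0 ≤ E by nlinarith [sq_nonneg ρ]).lt_or_eq with hE | hE
  · exact not_isAnalyticOnLevel hΨ hE hρ h.isAnalyticOnLevel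
  -- The level `0` is the zero section, which one has to leave.
  · have hρ0 : ρ = 0 := by
      rw [← hE] at hρ
      nlinarith [sq_nonneg ρ]
    have hz := eventually_eq_zero_of_analyticAt_waveIntegral (ρ := ρ) (A := e 2) (B := 0)
      (x := id) (y := 0) (G := pull Ψ) analyticAt_id analyticAt_const (by simp) rfl
      (by simp [hρ0]) (h _ (by simp [energy, ← hE]))
      (Filter.Eventually.of_forall fun t => by rw [hΨ])
    have hne : ∀ᶠ t : ℝ in 𝓝[≠] 0, False := by
      filter_upwards [nhdsWithin_le_nhds hz, self_mem_nhdsWithin] with t h1 h2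
      exact h2 (by simpa [hρ0] using h1)
    exact hne.exists.choose_spec

/-! ### Complete integrability for `b = 0` -/

lemma hasFDerivAt_shearIntegral_two (a : ℝ) (u : TN) : ∃ α, HasFDerivAt (shearIntegral 2 a)
    (covector α 0 0 0 (periodizeDeriv a (fibreCoord 2 u - a * baseCoord 0 u)) 0) u := by
  refine ⟨-(periodizeDeriv a (fibreCoord 2 u - a * baseCoord 0 u) * a),
    (hasFDerivAt_shearIntegral 2 a u).congr_fderiv (ContinuousLinearMap.ext fun U => ?_)⟩
  simp [covector]
  ring

lemma hasFDerivAt_shearIntegral_three (c : ℝ) (u : TN) : ∃ α, HasFDerivAt (shearIntegral 3 c)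
    (covector α 0 0 0 0 (periodizeDeriv c (fibreCoord 3 u - c * baseCoord 0 u))) u := by
  refine ⟨-(periodizeDeriv c (fibreCoord 3 u - c * baseCoord 0 u) * c),
    (hasFDerivAt_shearIntegral 3 c u).congr_fderiv (ContinuousLinearMap.ext fun U => ?_)⟩
  simp [covector]
  ring

/-- Complete integrability and the analyticity statements for `b = 0`, where the integrals depend on
the base point through `W₁` only. -/
theorem integrable_of_b_eq_zero (a c ρ : ℝ) : ∃ Γ : Subgroup Nil,
    (Γ : Set Nil) = expN '' (algLattice 2 1 1 1 : Set Alg) ∧ IsCocompactLattice Γ ∧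
    ∃ f : Fin 3 → TM Γ → ℝ,
      (∀ j, pull (f j) = integralsF (magneticForm a 0 c ρ) a c ρ j) ∧
      CompletelyIntegrableBy (magneticForm a 0 c ρ) f ∧
      (∀ E : ℝ, 0 < E → CompletelyIntegrableAtLevelBy (magneticForm a 0 c ρ) E f) ∧
      (a ≠ 0 → ∀ j, IsAnalytic (f j)) ∧
      (a = 0 →
        (∀ E : ℝ, E < ρ ^ 2 / 2 → ∀ j, IsAnalyticNearLevel E (f j)) ∧
        (∀ E : ℝ, ρ ^ 2 / 2 ≤ E → ¬ ∀ j, IsAnalyticNearLevel E (f j)) ∧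
        (∀ E : ℝ, 0 < E → ρ ^ 2 / 2 ≤ E → ¬ ∀ j, IsAnalyticOnLevel E (f j))) := by
  have hx : (2 : ℝ) * 1 = 2 * 1 := rfl
  refine ⟨expLattice 2 1 1 1 hx, rfl, isCocompactLattice_expLattice hx (by norm_num) (by norm_num)
    (by norm_num), ?_⟩
  have hex : ∀ j, ∃ Ψ : TM (expLattice 2 1 1 1 hx) → ℝ,
      pull Ψ = integralsF (magneticForm a 0 c ρ) a c ρ j := by
    intro j
    refine exists_pull_eq fun γ hγ p V => ?_
    obtain ⟨k, -, -, -, hk, -⟩ := mem_algLattice.1 (mem_expLattice.1 hγ)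
    rw [integralsF_eq]
    fin_cases j
    · exact waveIntegral_invariant a ρ hk p V
    · exact shearIntegral_invariant 2 a hk p V
    · exact shearIntegral_invariant 3 c hk p V
  choose f hf using hex
  refine ⟨f, hf, ?_⟩
  have hf' := hf
  simp only [integralsF_eq] at hf'
  have h0 : pull (f 0) = waveIntegral a ρ := hf' 0
  have h1 : pull (f 1) = shearIntegral 2 a := hf' 1
  have h2 : pull (f 2) = shearIntegral 3 c := hf' 2
  have hfirst : ∀ j, IsFirstIntegral (magneticForm a 0 c ρ) (f j) := by
    intro j
    constructor
    · fin_cases j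
      · exact h0 ▸ contDiff_waveIntegral a ρ
      · exact h1 ▸ contDiff_of_analyticAt (analyticAt_shearIntegral 2 a)
      · exact h2 ▸ contDiff_of_analyticAt (analyticAt_shearIntegral 3 c)
    · intro ε γ _ hγ s hs t ht
      change pull (f j) (γ s) = pull (f j) (γ t)
      fin_cases j
      · exact h0 ▸ waveIntegral_eq hγ hs ht
      · exact h1 ▸ congrArg (periodize a) (fibreCoord_two_sub_eq hγ hs ht)
      · exact h2 ▸ congrArg (periodize c) (fibreCoord_three_sub_eq hγ hs ht)
  -- No differential involves `dV₁` or `dW₂`, which makes all the brackets vanish.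
  have hder : ∀ j u, ∃ α y₁ y₂ y₃, HasFDerivAt (pull (f j)) (covector α 0 0 y₁ y₂ y₃) u := by
    intro j u
    fin_cases j
    · obtain ⟨α, y, h⟩ := hasFDerivAt_waveIntegral a ρ u
      exact ⟨_, _, _, _, h0 ▸ h⟩
    · obtain ⟨α, h⟩ := hasFDerivAt_shearIntegral_two a u
      exact ⟨_, _, _, _, h1 ▸ h⟩
    · obtain ⟨α, h⟩ := hasFDerivAt_shearIntegral_three c u
      exact ⟨_, _, _, _, h2 ▸ h⟩
  have hinv : InInvolution (magneticForm a 0 c ρ) f := by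
    intro i j u
    obtain ⟨_, _, _, _, hi⟩ := hder i u
    obtain ⟨_, _, _, _, hj⟩ := hder j u
    rw [poisson_eq hi hj]
    ring
  have hreg : ∀ E, 0 < E → {u | energy u = E} ⊆ closure ({u | energy u = E} ∩
      {u | LinearIndependent ℝ ![fderiv ℝ energy u, fderiv ℝ (pull (f 0)) u,
        fderiv ℝ (pull (f 1)) u, fderiv ℝ (pull (f 2)) u]}) := by
    intro E hE
    have he : ∀ i, e i ≠ 0 := fun i h => by
      have := congrArg (fun W : Alg => W i) h
      simp at this
    refine level_subset_closure_inter hE (he 0) (he 2) 0 (-ρ) (expN (e 0)) fun p V hV0 hV2 => ?_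
    have hV0' : V 0 ≠ 0 := by simpa [inner_eq] using hV0
    have hV2' : V 2 + ρ ≠ 0 := fun h => hV2 (by simp [inner_eq]; linarith)
    filter_upwards [eventually_waveCoeff_ne_zero a p hV2',
      eventually_periodizeDeriv_ne_zero a (V 2 - a * logN p 0),
      eventually_periodizeDeriv_ne_zero c (V 3 - c * logN p 0)] with t k0 k1 k2
    obtain ⟨_, _, d0⟩ := hasFDerivAt_waveIntegral a ρ (p + t • expN (e 0), V)
    obtain ⟨_, d1⟩ := hasFDerivAt_shearIntegral_two a (p + t • expN (e 0), V)
    obtain ⟨_, d2⟩ := hasFDerivAt_shearIntegral_three c (p + t • expN (e 0), V)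
    rw [h0, h1, h2, (hasFDerivAt_energy _).fderiv, d0.fderiv, d1.fderiv,
      d2.fderiv]
    refine linearIndependent_of_triangular hV0' k0 ?_ ?_
    · convert k1 using 2
      rw [baseCoord_add_smul, fibreCoord_apply, if_pos rfl]
      ring
    · convert k2 using 2
      rw [baseCoord_add_smul, fibreCoord_apply, if_pos rfl]
      ring
  obtain ⟨hCI, hCIL⟩ := completelyIntegrableBy_of_closure hfirst hinv hreg
  refine ⟨hCI, hCIL, fun ha j => ?_, ?_⟩
  · fin_cases j
    · exact fun u => h0 ▸ analyticAt_waveIntegral_of_ne ha ρ u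
    · exact fun u => h1 ▸ analyticAt_shearIntegral 2 a u
    · exact fun u => h2 ▸ analyticAt_shearIntegral 3 c u
  · rintro rfl
    refine ⟨fun E hE j u hu => ?_, fun E hE h => not_isAnalyticNearLevel h0 hE (h 0),
      fun E hE0 hE h => not_isAnalyticOnLevel h0 hE0 hE (h 0)⟩
    fin_cases j
    · refine h0 ▸ analyticAt_waveIntegral_zero fun h => ?_
      rw [energy, inner_eq] at hu
      rw [fibreCoord_apply] at h
      have : ρ = -u.2 2 := by linarith
      rw [this] at hE
      nlinarith [sq_nonneg (u.2 0), sq_nonneg (u.2 1), sq_nonneg (u.2 3)]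
    · exact h1 ▸ analyticAt_shearIntegral 2 0 u
    · exact h2 ▸ analyticAt_shearIntegral 3 c u

/-! ### Complete integrability for `c = 0`, `b ≠ 0` -/

/-- The integral `g₂` for `c = 0`. -/
def quadIntegral (a b ρ : ℝ) (u : TN) : ℝ :=
  b * fibreCoord 0 u - a * fibreCoord 1 u + 1 / 2 * (fibreCoord 2 u + ρ) ^ 2

/-- The integral `g₃` for `c = 0`. -/
def sineIntegral (a b : ℝ) (u : TN) : ℝ :=
  Real.sin (2 * Real.pi * (fibreCoord 2 u - (a * baseCoord 0 u + b * baseCoord 1 u)))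

lemma integralsG_eq (a b ρ : ℝ) : integralsG (magneticForm a b 0 ρ) a b ρ =
    ![quadIntegral a b ρ, sineIntegral a b, fun u => fibreCoord 3 u] := by
  funext j u
  fin_cases j
  · simp [integralsG, quadIntegral, momentum_zero, momentum_one, momentum_two]
    ring
  · simp [integralsG, sineIntegral, momentum_two]
  · simp [integralsG, momentum_three]

lemma sineIntegral_invariant {a b : ℝ} {γ : Nil} {k : ℤ}
    (hγ : a * logN γ 0 + b * logN γ 1 = k) (p : Nil) (V : Alg) :
    sineIntegral a b (γ * p, V) = sineIntegral a b (p, V) := by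
  have h : 2 * Real.pi * (V 2 - (a * logN (γ * p) 0 + b * logN (γ * p) 1))
      = 2 * Real.pi * (V 2 - (a * logN p 0 + b * logN p 1)) - k * (2 * Real.pi) := by
    rw [logN_mul, ← hγ]
    simp [bracket_apply]
    ring
  simp only [sineIntegral, fibreCoord_apply, baseCoord_apply, h, Real.sin_sub_int_mul_two_pi]

lemma analyticAt_quadIntegral (a b ρ : ℝ) (u : TN) : AnalyticAt ℝ (quadIntegral a b ρ) u :=
  ((analyticAt_const.mul (analyticAt_fibreCoord 0 u)).sub
    (analyticAt_const.mul (analyticAt_fibreCoord 1 u))).add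
    (analyticAt_const.mul (((analyticAt_fibreCoord 2 u).add analyticAt_const).pow 2))

lemma analyticAt_sineIntegral (a b : ℝ) (u : TN) : AnalyticAt ℝ (sineIntegral a b) u :=
  Real.analyticAt_sin.fun_comp (analyticAt_const.mul ((analyticAt_fibreCoord 2 u).sub
    ((analyticAt_const.mul (analyticAt_baseCoord 0 u)).add
      (analyticAt_const.mul (analyticAt_baseCoord 1 u)))))

lemma hasFDerivAt_quadIntegral (a b ρ : ℝ) (u : TN) :
    HasFDerivAt (quadIntegral a b ρ) (covector 0 0 b (-a) (fibreCoord 2 u + ρ) 0) u := by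
  have hf : ∀ i, HasFDerivAt (fun v => fibreCoord i v) (fibreCoord i) u :=
    fun i => (fibreCoord i).hasFDerivAt
  refine ((((hf 0).const_mul b).sub ((hf 1).const_mul a)).add
    ((((hf 2).add_const ρ).pow 2).const_mul (1 / 2))).congr_fderiv
      (ContinuousLinearMap.ext fun U => ?_)
  simp [covector]
  ring

/-- The derivative of `sineIntegral` in the direction of `V₃`. -/
def sineCoeff (a b : ℝ) (u : TN) : ℝ :=
  Real.cos (2 * Real.pi * (fibreCoord 2 u - (a * baseCoord 0 u + b * baseCoord 1 u)))
    * (2 * Real.pi)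

lemma hasFDerivAt_sineIntegral (a b : ℝ) (u : TN) :
    HasFDerivAt (sineIntegral a b)
      (covector (-(a * sineCoeff a b u)) (-(b * sineCoeff a b u)) 0 0 (sineCoeff a b u) 0) u := by
  have hb : ∀ i, HasFDerivAt (fun v => baseCoord i v) (baseCoord i) u :=
    fun i => (baseCoord i).hasFDerivAt
  have hf : HasFDerivAt (fun v => fibreCoord 2 v) (fibreCoord 2) u := (fibreCoord 2).hasFDerivAt
  refine ((hf.sub (((hb 0).const_mul a).add ((hb 1).const_mul b))).const_mul
    (2 * Real.pi)).sin.congr_fderiv (ContinuousLinearMap.ext fun U => ?_)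
  simp [covector, sineCoeff]
  ring

lemma hasFDerivAt_fibreCoord_three (u : TN) :
    HasFDerivAt (fun v => fibreCoord 3 v) (covector 0 0 0 0 0 1) u :=
  (fibreCoord 3).hasFDerivAt.congr_fderiv (ContinuousLinearMap.ext fun U => by simp [covector])

/-- The conclusions for `c = 0` and `b ≠ 0`, for any lattice such that `b x₂ = 1` and `a x₁` is
an integer. -/
theorem integrable_of_c_eq_zero {a b ρ x₁ x₂ x₃ : ℝ} (hb : b ≠ 0) (hx : x₁ * x₂ = 2 * x₃)
    (h₁ : x₁ ≠ 0) (h₂ : b * x₂ = 1) {n : ℤ} (hn : a * x₁ = n) : ∃ Γ : Subgroup Nil,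
    (Γ : Set Nil) = expN '' (algLattice x₁ x₂ x₃ 1 : Set Alg) ∧ IsCocompactLattice Γ ∧
    ∃ g : Fin 3 → TM Γ → ℝ,
      (∀ j, pull (g j) = integralsG (magneticForm a b 0 ρ) a b ρ j) ∧
      CompletelyIntegrableBy (magneticForm a b 0 ρ) g ∧
      (∀ E : ℝ, 0 < E → CompletelyIntegrableAtLevelBy (magneticForm a b 0 ρ) E g) ∧
      ∀ j, IsAnalytic (g j) := by
  refine ⟨expLattice x₁ x₂ x₃ 1 hx, rfl, isCocompactLattice_expLattice hx h₁
    (right_ne_zero_of_mul_eq_one h₂) one_ne_zero, ?_⟩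
  have hex : ∀ j, ∃ Ψ : TM (expLattice x₁ x₂ x₃ 1 hx) → ℝ,
      pull Ψ = integralsG (magneticForm a b 0 ρ) a b ρ j := by
    intro j
    refine exists_pull_eq fun γ hγ p V => ?_
    obtain ⟨k, l, -, -, hk, hl, -⟩ := mem_algLattice.1 (mem_expLattice.1 hγ)
    rw [integralsG_eq]
    fin_cases j
    · rfl
    · refine sineIntegral_invariant (k := k * n + l) ?_ p V
      rw [hk, hl]
      push_cast
      linear_combination (k : ℝ) * hn + (l : ℝ) * h₂
    · rfl
  choose g hg using hex
  refine ⟨g, hg, ?_⟩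
  have hg' := hg
  simp only [integralsG_eq] at hg'
  have h0 : pull (g 0) = quadIntegral a b ρ := hg' 0
  have h1 : pull (g 1) = sineIntegral a b := hg' 1
  have h2 : pull (g 2) = fun u => fibreCoord 3 u := hg' 2
  have han : ∀ j, IsAnalytic (g j) := by
    intro j u
    fin_cases j
    · exact h0 ▸ analyticAt_quadIntegral a b ρ u
    · exact h1 ▸ analyticAt_sineIntegral a b u
    · exact h2 ▸ analyticAt_fibreCoord 3 u
  have hfirst : ∀ j, IsFirstIntegral (magneticForm a b 0 ρ) (g j) := by
    refine fun j => ⟨contDiff_of_analyticAt (han j), fun ε γ _ hγ s hs t ht => ?_⟩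
    refine eq_of_hasDerivAt_zero (f := fun r => pull (g j) (γ r)) (fun r hr => ?_) hs ht
    obtain ⟨⟨hb0, hb1⟩, d0, d1, d2, d3⟩ := hγ.hasDerivAt hr
    fin_cases j
    · simp only [Fin.zero_eta, h0]
      refine (((d0.const_mul b).sub (d1.const_mul a)).add
        (((d2.add_const ρ).pow 2).const_mul (1 / 2))).congr_deriv ?_
      simp
      ring
    · simp only [Fin.mk_one, h1]
      refine ((d2.sub ((hb0.const_mul a).add (hb1.const_mul b))).const_mul
        (2 * Real.pi)).sin.congr_deriv ?_
      ring
    · simp only [Fin.reduceFinMk, h2]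
      exact d3.congr_deriv (by ring)
  have hinv : InInvolution (magneticForm a b 0 ρ) g := by
    intro i j u
    have d0 := h0 ▸ hasFDerivAt_quadIntegral a b ρ u
    have d1 := h1 ▸ hasFDerivAt_sineIntegral a b u
    have d2 := h2 ▸ hasFDerivAt_fibreCoord_three u
    fin_cases i <;> fin_cases j
    · exact (poisson_eq d0 d0).trans (by ring)
    · exact (poisson_eq d0 d1).trans (by ring)
    · exact (poisson_eq d0 d2).trans (by ring)
    · exact (poisson_eq d1 d0).trans (by ring)
    · exact (poisson_eq d1 d1).trans (by ring)
    · exact (poisson_eq d1 d2).trans (by ring)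
    · exact (poisson_eq d2 d0).trans (by ring)
    · exact (poisson_eq d2 d1).trans (by ring)
    · exact (poisson_eq d2 d2).trans (by ring)
  have hreg : ∀ E, 0 < E → {u | energy u = E} ⊆ closure ({u | energy u = E} ∩
      {u | LinearIndependent ℝ ![fderiv ℝ energy u, fderiv ℝ (pull (g 0)) u,
        fderiv ℝ (pull (g 1)) u, fderiv ℝ (pull (g 2)) u]}) := by
    intro E hE
    have hm : (!₂[a, b, 0, 0] : Alg) ≠ 0 := fun h => hb (congrArg (fun W : Alg => W 1) h)
    refine level_subset_closure_inter hE hm hm 0 0 (expN (e 1)) fun p V hV _ => ?_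
    have hV' : a * V 0 + b * V 1 ≠ 0 := by simpa [inner_eq] using hV
    filter_upwards [eventually_cos_add_mul_ne_zero
      (2 * Real.pi * (V 2 - (a * logN p 0 + b * logN p 1)))
      (c := -(2 * Real.pi * b)) (by simpa using hb)] with t ht
    rw [h0, h1, h2, (hasFDerivAt_energy _).fderiv,
      (hasFDerivAt_quadIntegral a b ρ _).fderiv, (hasFDerivAt_sineIntegral a b _).fderiv,
      (hasFDerivAt_fibreCoord_three _).fderiv]
    refine linearIndependent_of_mul_add_mul_ne_zero hb
      (mul_ne_zero ?_ (mul_ne_zero two_ne_zero Real.pi_ne_zero)) hV'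
    convert ht using 2
    rw [baseCoord_add_smul, baseCoord_add_smul, fibreCoord_apply]
    simp
    ring
  obtain ⟨hCI, hCIL⟩ := completelyIntegrableBy_of_closure hfirst hinv hreg
  exact ⟨hCI, hCIL, han⟩

end KodairaThurston

end

open KodairaThurston in
theorem mainTheorem3 :
    (∀ a b c ρ : ℝ, Module.finrank ℝ (LinearMap.range (lorentz (magneticForm a b c ρ))) = 2 →
      b * c = 0 ∧
      -- the case `b = 0`
      (b = 0 → ∃ Γ : Subgroup Nil,
        (Γ : Set Nil) = expN '' (algLattice 2 1 1 1 : Set Alg) ∧ IsCocompactLattice Γ ∧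
        ∃ f : Fin 3 → TM Γ → ℝ,
          (∀ j, pull (f j) = integralsF (magneticForm a b c ρ) a c ρ j) ∧
          CompletelyIntegrableBy (magneticForm a b c ρ) f ∧
          (∀ E : ℝ, 0 < E → CompletelyIntegrableAtLevelBy (magneticForm a b c ρ) E f) ∧
          (a ≠ 0 → ∀ j, IsAnalytic (f j)) ∧
          (a = 0 →
            (∀ E : ℝ, E < ρ ^ 2 / 2 → ∀ j, IsAnalyticNearLevel E (f j)) ∧
            (∀ E : ℝ, ρ ^ 2 / 2 ≤ E → ¬ ∀ j, IsAnalyticNearLevel E (f j)) ∧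
            (∀ E : ℝ, 0 < E → ρ ^ 2 / 2 ≤ E → ¬ ∀ j, IsAnalyticOnLevel E (f j)))) ∧
      -- the case `c = 0`, `b ≠ 0`
      (c = 0 → b ≠ 0 → ∃ Γ : Subgroup Nil,
        (Γ : Set Nil) = expN '' ((if a = 0 then algLattice 2 (1 / b) (1 / b) 1
          else algLattice (2 / a) (1 / b) (1 / (a * b)) 1 : Submodule ℤ Alg) : Set Alg) ∧
        IsCocompactLattice Γ ∧
        ∃ g : Fin 3 → TM Γ → ℝ,
          (∀ j, pull (g j) = integralsG (magneticForm a b c ρ) a b ρ j) ∧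
          CompletelyIntegrableBy (magneticForm a b c ρ) g ∧
          (∀ E : ℝ, 0 < E → CompletelyIntegrableAtLevelBy (magneticForm a b c ρ) E g) ∧
          ∀ j, IsAnalytic (g j))) ∧
    -- the exact form `ρ de³`
    (∀ ρ : ℝ, ρ ≠ 0 → ∃ Γ : Subgroup Nil,
      (Γ : Set Nil) = expN '' (algLattice 2 1 1 1 : Set Alg) ∧ IsCocompactLattice Γ ∧
      ∃ f : Fin 3 → TM Γ → ℝ,
        (∀ j, pull (f j) = integralsF (ρ • extDiff (dual 2)) 0 0 (-ρ) j) ∧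
        CompletelyIntegrableBy (ρ • extDiff (dual 2)) f ∧
        (∀ E : ℝ, 0 < E → CompletelyIntegrableAtLevelBy (ρ • extDiff (dual 2)) E f) ∧
        (∀ E : ℝ, E < ρ ^ 2 / 2 → ∀ j, IsAnalyticNearLevel E (f j)) ∧
        (∀ E : ℝ, ρ ^ 2 / 2 ≤ E → ¬ ∀ j, IsAnalyticOnLevel E (f j))) := by
  refine ⟨fun a b c ρ h => ⟨mul_eq_zero_of_finrank_range h, ?_, ?_⟩, fun ρ hρ => ?_⟩
  · rintro rfl
    exact integrable_of_b_eq_zero a c ρ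
  · rintro rfl hb
    by_cases ha : a = 0
    · simp only [if_pos ha]
      exact integrable_of_c_eq_zero hb (by ring) two_ne_zero (by field_simp) (n := 0) (by simp [ha])
    · simp only [if_neg ha]
      exact integrable_of_c_eq_zero hb (by field_simp) (div_ne_zero two_ne_zero ha)
        (by field_simp) (n := 2) (by field_simp; norm_num)
  · obtain ⟨Γ, hΓ, hΓ', f, hf, h1, h2, -, h3⟩ := integrable_of_b_eq_zero 0 0 (-ρ)
    obtain ⟨h4, -, h5⟩ := h3 rfl
    rw [neg_sq] at h4 h5
    rw [smul_extDiff_dual_two]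
    refine ⟨Γ, hΓ, hΓ', f, hf, h1, h2, h4, fun E hE => h5 E ?_ hE⟩
    exact lt_of_lt_of_le (by positivity) hE
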